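/- A group is \emph{coherent} if all its finitely generated subgroups are finitely presented. Let $G$ be a group with a finite generating tuple $a=(a_1,\dots,a_n)$. A \emph{coherence algorithm} for $G$ (with respect to $a$) is an algorithm which, on input finitely many words on $a_1^{\pm1},\dots,a_n^{\pm1}$ representing elements $h_1,\dots,h_r\in G$ ($r\ge 0$ arbitrary), halts and outputs the relators of a finite presentation of $H=\langle h_1,\dots,h_r\rangle\leqslant G$ on the given generators, that is, finitely many words in the free group $\mathbb F_r$ on $x_1,\dots,x_r$ whose normal closure is the kernel of $\mathbb F_r\to G$, $x_i\mapsto h_i$. The group $G$ is \emph{effectively coherent} (with respect to $a$) if it is coherent and has a coherence algorithm. \textbf{Theorem.} Let $G$ be a group and let $F\leqslant G$ be a subgroup of finite index. (i) $F$ is coherent if and only if $G$ is coherent. (ii) Let $G=\langle a_1,\dots,a_n\mid R\rangle$ be a finite presentation. Then, with respect to $a$ and to any finite generating tuple of $F$, $F$ is effectively coherent if and only if $G$ is effectively coherent. Moreover, (ii) is uniform in the data by which $G$ and $F$ are given: (a) Suppose $F$ is given by words on $a_1^{\pm1},\dots,a_n^{\pm 1}$ representing elements $f_1,\dots,f_k$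 that generate $F$. There is a computable procedure which, from $n$, $R$, these words and a coherence algorithm for $F$ (with respect to $f_1,\dots,f_k$), produces a coherence algorithm for $G$ (with respect to $a$); and there is a computable procedure which, from the same data with a coherence algorithm for $G$, produces one for $F$. (b) Suppose instead that $F$ is given by an algorithm which decides whether a word on $a_1^{\pm1},\dots,a_n^{\pm1}$ represents an element of $F$. Then the same holds from $n$, $R$ and this membership algorithm, where now a coherence algorithm for $F$ takes as input finitely many words on $a_1^{\pm1},\dots,a_n^{\pm1}$ that represent elements of $F$ (and has to work on such inputs only). (c) The two ways of giving $F$ are equivalent: there is a computable procedure which from $n$, $R$ and words as in (a) produces a membership algorithm as in (b), and one which from $n$, $R$ and a membership algorithm as in (b) produces words as in (a). In (a)--(c) each procedure is a single one that serves all groups $G$ and all finite-index subgroups $F$. -/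

import Mathlib

universe u

/-- A group is coherent if all its finitely generated subgroups are finitely presented. -/
def IsCoherent (G : Type*) [Group G] : Prop :=
  ∀ H : Subgroup G, H.FG → Group.IsFinitelyPresented H

/-- A word in the letters `x₀, x₁, x₂, …` and their formal inverses: the pair `(i, true)` stands for
the letter `xᵢ`, the pair `(i, false)` for its inverse. A word need not be reduced. -/
abbrev GroupWord : Type := List (ℕ × Bool)

namespace GroupWord

/-- Only the letters `x₀, …, xₙ₋₁` and their inverses occur in `w`. -/
def IsOn (n : ℕ) (w : GroupWord) : Prop :=
  ∀ p ∈ w, p.1 < n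

/-- The element of the free group of rank `n` that is spelled by a word on `x₀, …, xₙ₋₁`.
(The definition ignores other letters; it is only used for words that satisfy `IsOn n`.) -/
def toFree (n : ℕ) (w : GroupWord) : FreeGroup (Fin n) :=
  FreeGroup.lift (fun i : ℕ => if h : i < n then FreeGroup.of (⟨i, h⟩ : Fin n) else 1)
    (FreeGroup.mk w)

/-- The element `w(a₀, …, aₙ₋₁)` of `G`. -/
def eval {G : Type*} [Group G] {n : ℕ} (a : Fin n → G) (w : GroupWord) : G :=
  FreeGroup.lift a (toFree n w)

end GroupWord

/-- The words `rels` on `x₀, …, xᵣ₋₁` are the relators of a (finite) presentation, on the given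
generators `h₀, …, hᵣ₋₁`, of the subgroup of `G` which these elements generate: the kernel of
`xᵢ ↦ hᵢ` is the normal closure of `rels` in the free group of rank `r`. -/
def IsPresentationOn {G : Type*} [Group G] {r : ℕ} (h : Fin r → G) (rels : List GroupWord) : Prop :=
  (∀ w ∈ rels, w.IsOn r) ∧
    (FreeGroup.lift h).ker =
      Subgroup.normalClosure {u : FreeGroup (Fin r) | ∃ w ∈ rels, u = w.toFree r}

/-- `G = ⟨a₀, …, aₙ₋₁ ∣ R⟩`, a finite presentation of the whole group. -/
def Presents {G : Type*} [Group G] {n : ℕ} (a : Fin n → G) (R : List GroupWord) : Prop :=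
  Subgroup.closure (Set.range a) = ⊤ ∧ IsPresentationOn a R

/-- On input words `h₀, …, hᵣ₋₁` on the generators `a` of `G`, with `r` arbitrary, the program `c`
halts and outputs the relators of a finite presentation, on the given generators, of the subgroup
of `G` generated by `h₀, …, hᵣ₋₁`. -/
def IsCoherenceAlgorithm {G : Type*} [Group G] {n : ℕ} (c : Nat.Partrec.Code) (a : Fin n → G) :
    Prop :=
  ∀ hs : List GroupWord, (∀ h ∈ hs, h.IsOn n) →
    ∃ out : List GroupWord, Encodable.encode out ∈ c.eval (Encodable.encode hs) ∧
      IsPresentationOn (fun i : Fin hs.length => (hs.get i).eval a) out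

/-- The same for a subgroup `F` of `G` whose elements are given as words on the generators `a`
of `G`: the input words are promised to represent elements of `F`. -/
def IsCoherenceAlgorithmWithin {G : Type*} [Group G] {n : ℕ} (c : Nat.Partrec.Code)
    (a : Fin n → G) (F : Subgroup G) : Prop :=
  ∀ hs : List GroupWord, (∀ h ∈ hs, h.IsOn n ∧ h.eval a ∈ F) →
    ∃ out : List GroupWord, Encodable.encode out ∈ c.eval (Encodable.encode hs) ∧
      IsPresentationOn (fun i : Fin hs.length => (hs.get i).eval a) out

/-- The group `G`, with the finite generating tuple `a`, is effectively coherent. -/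
def IsEffectivelyCoherent {G : Type*} [Group G] {n : ℕ} (a : Fin n → G) : Prop :=
  IsCoherent G ∧ ∃ c : Nat.Partrec.Code, IsCoherenceAlgorithm c a

/-- The words `fs` on the generators `a` of `G` spell the elements `f₀, …, fᵣ₋₁` of the
subgroup `F`, and these elements generate `F`. -/
def GeneratesVia {G : Type*} [Group G] {n : ℕ} (a : Fin n → G) (F : Subgroup G)
    (fs : List GroupWord) (f : Fin fs.length → F) : Prop :=
  (∀ w ∈ fs, w.IsOn n) ∧ (∀ i, (f i : G) = (fs.get i).eval a) ∧
    Subgroup.closure (Set.range f) = ⊤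

/-- The program `m` solves the membership problem for `F` in `G`: on input a word on the generators
`a` of `G`, it halts and tells whether the word represents an element of `F`. -/
def DecidesMembership {G : Type*} [Group G] {n : ℕ} (m : Nat.Partrec.Code) (a : Fin n → G)
    (F : Subgroup G) : Prop :=
  ∀ w : GroupWord, w.IsOn n →
    ∃ b : Bool, Encodable.encode b ∈ m.eval (Encodable.encode w) ∧ (b = true ↔ w.eval a ∈ F)

open Encodable GroupWord

/-! ### Semidecidable predicates and uniform search -/

/-- A predicate is semidecidable if it is a projection of a primitive recursive relation. -/
def SemiDec {α : Type*} [Primcodable α] (p : α → Prop) : Prop :=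
  ∃ q : α → ℕ → Prop, PrimrecRel q ∧ ∀ a, p a ↔ ∃ k, q a k

theorem PrimrecPred.semiDec {α : Type*} [Primcodable α] {p : α → Prop} (hp : PrimrecPred p) :
    SemiDec p :=
  ⟨fun a _ => p a, hp.comp Primrec.fst, fun _ => by simp⟩

theorem PrimrecRel.mem_list {α : Type*} [Primcodable α] :
    PrimrecRel fun (a : α) (l : List α) => a ∈ l :=
  (PrimrecRel.exists_mem_list (Primrec.eq (α := α))).swap.of_eq fun a l => by simp

theorem PrimrecRel.mem_option {α : Type*} [Primcodable α] :
    PrimrecRel fun (a : α) (l : Option α) => a ∈ l :=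
  (Primrec.eq.comp₂ (Primrec₂.right) (Primrec.option_some.comp₂ Primrec₂.left)).of_eq
    fun a l => by simp [Option.mem_def]

namespace SemiDec

variable {α β γ : Type*} [Primcodable α] [Primcodable β] [Primcodable γ]

theorem of_iff {p q : α → Prop} (hp : SemiDec p) (h : ∀ a, q a ↔ p a) : SemiDec q := by
  obtain rfl : q = p := funext fun a => propext (h a)
  exact hp

theorem comp {p : β → Prop} {f : α → β} (hp : SemiDec p) (hf : Primrec f) :
    SemiDec fun a => p (f a) := by
  obtain ⟨q, hq, h⟩ := hp
  exact ⟨fun a k => q (f a) k, hq.comp₂ (hf.comp₂ Primrec₂.left) Primrec₂.right, fun a => h _⟩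

theorem and {p q : α → Prop} (hp : SemiDec p) (hq : SemiDec q) : SemiDec fun a => p a ∧ q a := by
  obtain ⟨r, hr, h⟩ := hp
  obtain ⟨s, hs, h'⟩ := hq
  have u : Primrec₂ fun (_ : α) (k : ℕ) => k.unpair := Primrec.unpair.comp₂ Primrec₂.right
  refine ⟨fun a k => r a k.unpair.1 ∧ s a k.unpair.2,
    (hr.comp₂ Primrec₂.left (Primrec.fst.comp₂ u)).and
      (hs.comp₂ Primrec₂.left (Primrec.snd.comp₂ u)), fun a => ?_⟩
  simp only [h, h']
  constructor
  · rintro ⟨⟨k, hk⟩, l, hl⟩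
    exact ⟨Nat.pair k l, by simpa using ⟨hk, hl⟩⟩
  · rintro ⟨k, hk, hl⟩
    exact ⟨⟨_, hk⟩, _, hl⟩

theorem or {p q : α → Prop} (hp : SemiDec p) (hq : SemiDec q) : SemiDec fun a => p a ∨ q a := by
  obtain ⟨r, hr, h⟩ := hp
  obtain ⟨s, hs, h'⟩ := hq
  exact ⟨fun a k => r a k ∨ s a k, hr.or hs, fun a => by simp only [h, h', exists_or]⟩

theorem ex {p : α → β → Prop} (hp : SemiDec fun x : α × β => p x.1 x.2) :
    SemiDec fun a => ∃ b, p a b := by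
  obtain ⟨q, hq, h⟩ := hp
  have : PrimrecRel fun (x : α × ℕ) (y : β × ℕ) => q (x.1, y.1) y.2 :=
    hq.comp₂ (Primrec₂.pair.comp₂ (Primrec.fst.comp₂ Primrec₂.left)
      (Primrec.fst.comp₂ Primrec₂.right))
      (Primrec.snd.comp₂ Primrec₂.right)
  -- A single number codes both `b` and its witness; a number that decodes to nothing gives an empty
  -- list and fails.
  refine ⟨fun a k => ∃ y ∈ (decode (α := β × ℕ) k).toList, q (a, y.1) y.2, ?_, fun a => ?_⟩
  · exact (PrimrecRel.exists_mem_list this.swap).comp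
      (Primrec.optionToList.comp (Primrec.decode.comp Primrec.snd)) Primrec.id
  · constructor
    · rintro ⟨b, hb⟩
      obtain ⟨k, hk⟩ := (h (a, b)).1 hb
      exact ⟨encode (b, k), (b, k), by simp, hk⟩
    · rintro ⟨k, y, -, hy⟩
      exact ⟨y.1, (h (a, y.1)).2 ⟨_, hy⟩⟩

theorem ex_mem {p : α → β → Prop} {l : α → List β} (hl : Primrec l)
    (hp : SemiDec fun x : α × β => p x.1 x.2) : SemiDec fun a => ∃ b ∈ l a, p a b :=
  ex ((PrimrecRel.mem_list.comp Primrec.snd (hl.comp Primrec.fst)).semiDec.and hp)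

theorem all_mem {p : α → β → Prop} {l : α → List β} (hl : Primrec l)
    (hp : SemiDec fun x : α × β => p x.1 x.2) : SemiDec fun a => ∀ b ∈ l a, p a b := by
  obtain ⟨q, hq, h⟩ := hp
  have h₁ : PrimrecRel fun (k : ℕ) (x : α × β) => ∃ j < k, q x j :=
    ((PrimrecRel.exists_mem_list hq.swap).comp₂ (Primrec.list_range.comp₂ Primrec₂.left)
      Primrec₂.right).of_eq fun k x => by simp [Function.swap]
  have h₂ : PrimrecRel fun (b : β) (y : α × ℕ) => ∃ j < y.2, q (y.1, b) j :=
    h₁.comp₂ (Primrec.snd.comp₂ Primrec₂.right)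
      (Primrec₂.pair.comp₂ (Primrec.fst.comp₂ Primrec₂.right) Primrec₂.left)
  refine ⟨fun a k => ∀ b ∈ l a, ∃ j < k, q (a, b) j, ?_, fun a => ?_⟩
  · exact (PrimrecRel.forall_mem_list h₂).comp (hl.comp Primrec.fst) Primrec.id
  · constructor
    · intro H
      choose! f hf using fun b hb => (h (a, b)).1 (H b hb)
      -- The sum bounds every chosen witness; the `+ 1` makes the bound strict.
      refine ⟨((l a).map f).sum + 1, fun b hb => ⟨f b, ?_, hf b hb⟩⟩
      exact Nat.lt_succ_of_le (List.le_sum_of_mem (List.mem_map_of_mem hb))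
    · rintro ⟨k, hk⟩ b hb
      obtain ⟨j, -, hj⟩ := hk b hb
      exact (h (a, b)).2 ⟨j, hj⟩

/-- Evaluation with bounded resources is primitive recursive, also in the code; this lets a search
run programs that are part of its input. -/
theorem mem_eval {c : α → Nat.Partrec.Code} {x y : α → ℕ} (hc : Primrec c) (hx : Primrec x)
    (hy : Primrec y) : SemiDec fun a => y a ∈ (c a).eval (x a) := by
  refine ⟨fun a k => y a ∈ (c a).evaln k (x a), ?_, fun a => Nat.Partrec.Code.evaln_complete⟩
  exact PrimrecRel.mem_option.comp (hy.comp Primrec.fst)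
    (Nat.Partrec.Code.primrec_evaln.comp
      ((Primrec.snd.pair (hc.comp Primrec.fst)).pair (hx.comp Primrec.fst)))

/-- A semidecidable relation has a partial recursive uniformization. -/
theorem exists_partrec {p : α × β → Prop} (hp : SemiDec p) :
    ∃ f : α →. β, Partrec f ∧ (∀ a, ∀ b ∈ f a, p (a, b)) ∧ ∀ a, (∃ b, p (a, b)) → (f a).Dom := by
  classical
  obtain ⟨q, hq, h⟩ := hp
  let g : α → ℕ → Option β := fun a k =>
    (decode (α := β × ℕ) k).bind fun y => if q (a, y.1) y.2 then some y.1 else none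
  have hg : Primrec₂ g := by
    refine Primrec.option_bind (Primrec.decode.comp Primrec.snd) ?_
    refine Primrec.ite ?_ (Primrec.option_some.comp (Primrec.fst.comp Primrec.snd))
      (Primrec.const none)
    exact hq.comp (((Primrec.fst.comp Primrec.fst)).pair (Primrec.fst.comp Primrec.snd))
      (Primrec.snd.comp Primrec.snd)
  refine ⟨fun a => Nat.rfindOpt (g a), Partrec.rfindOpt hg.to_comp, fun a b hb => ?_, ?_⟩
  · obtain ⟨k, hk⟩ := Nat.rfindOpt_spec hb
    simp only [g, Option.mem_def, Option.bind_eq_some_iff] at hk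
    obtain ⟨y, -, hy⟩ := hk
    split_ifs at hy with hqy
    cases hy
    exact (h _).2 ⟨_, hqy⟩
  · rintro a ⟨b, hb⟩
    obtain ⟨k, hk⟩ := (h _).1 hb
    exact Nat.rfindOpt_dom.2 ⟨encode (b, k), b, by simp [g, hk]⟩

end SemiDec

/-- A partial recursive function of two arguments is computed by codes that depend
computably on the first argument. -/
theorem Partrec.exists_computable_code {α β γ : Type*} [Primcodable α] [Primcodable β]
    [Primcodable γ] {f : α × β →. γ} (hf : Partrec f) :
    ∃ up : α → Nat.Partrec.Code, Computable up ∧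
      ∀ a b, ∀ c ∈ f (a, b), encode c ∈ (up a).eval (encode b) := by
  obtain ⟨c, hc⟩ := Nat.Partrec.Code.exists_code.1 hf
  -- This is the s-m-n theorem: hard-wiring the first argument is primitive recursive.
  refine ⟨fun a => c.curry (encode a),
    (Nat.Partrec.Code.primrec₂_curry.comp (Primrec.const c) Primrec.encode).to_comp,
    fun a b x hx => ?_⟩
  rw [Nat.Partrec.Code.eval_curry, hc]
  simpa [encode_prod_val] using Part.mem_map encode hx

/-- A semidecidable search problem is solved by codes that depend computably on its
parameters. -/
theorem SemiDec.exists_code {α β γ : Type*} [Primcodable α] [Primcodable β] [Primcodable γ]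
    {p : (α × β) × γ → Prop} (hp : SemiDec p) :
    ∃ up : α → Nat.Partrec.Code, Computable up ∧ ∀ a b, (∃ c, p ((a, b), c)) →
      ∃ c, encode c ∈ (up a).eval (encode b) ∧ p ((a, b), c) := by
  obtain ⟨f, hf, hs, hd⟩ := hp.exists_partrec
  obtain ⟨up, hup, h⟩ := hf.exists_computable_code
  refine ⟨up, hup, fun a b hc => ?_⟩
  obtain ⟨c, hc⟩ := Part.dom_iff_mem.1 (hd (a, b) hc)
  exact ⟨c, h a b c hc, hs _ c hc⟩

/-! ### Words: computability, substitution, evaluation -/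

theorem FreeGroup.primrec_invRev {α : Type*} [Primcodable α] :
    Primrec (FreeGroup.invRev : List (α × Bool) → List (α × Bool)) :=
  Primrec.list_reverse.comp <| Primrec.list_map Primrec.id
    ((Primrec.fst.pair (Primrec.not.comp Primrec.snd)).comp Primrec.snd)

theorem FreeGroup.primrec_reduce {α : Type*} [Primcodable α] [DecidableEq α] :
    Primrec (FreeGroup.reduce : List (α × Bool) → List (α × Bool)) := by
  refine (Primrec.list_rec (f := id) (g := fun _ : List (α × Bool) => ([] : List (α × Bool)))
    (h := fun _ p => List.casesOn p.2.2 [p.1] fun x t =>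
      if p.1.1 = x.1 ∧ p.1.2 = !x.2 then t else p.1 :: x :: t)
    Primrec.id (Primrec.const []) ?_).of_eq fun l => rfl
  have head : Primrec fun x : List (α × Bool) × (α × Bool) × List (α × Bool) × List (α × Bool) =>
      x.2.1 := Primrec.fst.comp Primrec.snd
  refine Primrec.list_casesOn (h := fun x (q : (α × Bool) × List (α × Bool)) =>
      if x.2.1.1 = q.1.1 ∧ x.2.1.2 = !q.1.2 then q.2 else x.2.1 :: q.1 :: q.2)
    (Primrec.snd.comp (Primrec.snd.comp Primrec.snd))
    (Primrec.list_cons.comp head (Primrec.const [])) ?_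
  have t : Primrec fun x : (List (α × Bool) × (α × Bool) × List (α × Bool) × List (α × Bool)) ×
      (α × Bool) × List (α × Bool) => x.1.2.1 := head.comp Primrec.fst
  have h₁ : Primrec fun x : (List (α × Bool) × (α × Bool) × List (α × Bool) × List (α × Bool)) ×
      (α × Bool) × List (α × Bool) => x.2.1 := Primrec.fst.comp Primrec.snd
  have h₂ : Primrec fun x : (List (α × Bool) × (α × Bool) × List (α × Bool) × List (α × Bool)) ×
      (α × Bool) × List (α × Bool) => x.2.2 := Primrec.snd.comp Primrec.snd
  refine Primrec.ite ?_ h₂ (Primrec.list_cons.comp t (Primrec.list_cons.comp h₁ h₂))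
  exact (Primrec.eq.comp (Primrec.fst.comp t) (Primrec.fst.comp h₁)).and
    (Primrec.eq.comp (Primrec.snd.comp t) (Primrec.not.comp (Primrec.snd.comp h₁)))

namespace GroupWord

/-- The word obtained from `v` by substituting the words `ks` for the letters. -/
def subst (ks : List GroupWord) (v : GroupWord) : GroupWord :=
  v.flatMap fun p => bif p.2 then ks.getD p.1 [] else FreeGroup.invRev (ks.getD p.1 [])

theorem primrec_subst : Primrec₂ subst := by
  have h : Primrec fun x : (List GroupWord × GroupWord) × (ℕ × Bool) => x.1.1.getD x.2.1 [] :=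
    (Primrec.list_getD []).comp (Primrec.fst.comp Primrec.fst) (Primrec.fst.comp Primrec.snd)
  exact Primrec.list_flatMap Primrec.snd
    (Primrec.cond (Primrec.snd.comp Primrec.snd) h (FreeGroup.primrec_invRev.comp h))

theorem primrecRel_isOn : PrimrecRel IsOn := by
  have : PrimrecRel fun (p : ℕ × Bool) (n : ℕ) => p.1 < n :=
    Primrec.nat_lt.comp (Primrec.fst.comp Primrec.fst) Primrec.snd
  exact (PrimrecRel.forall_mem_list this).swap

section IsOn

variable {n : ℕ} {u v : GroupWord}

theorem isOn_nil (n : ℕ) : IsOn n [] := by simp [IsOn]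

theorem isOn_append : IsOn n (u ++ v) ↔ IsOn n u ∧ IsOn n v := by
  simp [IsOn, or_imp, forall_and]

theorem IsOn.append (hu : IsOn n u) (hv : IsOn n v) : IsOn n (u ++ v) :=
  isOn_append.2 ⟨hu, hv⟩

theorem IsOn.invRev (hu : IsOn n u) : IsOn n (FreeGroup.invRev u) := by
  intro p hp
  simp only [FreeGroup.invRev, List.mem_reverse, List.mem_map] at hp
  obtain ⟨q, hq, rfl⟩ := hp
  exact hu q hq

theorem isOn_getD {ks : List GroupWord} (h : ∀ k ∈ ks, IsOn n k) (i : ℕ) :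
    IsOn n (ks.getD i []) := by
  rcases lt_or_ge i ks.length with hi | hi
  · rw [List.getD_eq_getElem _ _ hi]
    exact h _ (List.getElem_mem hi)
  · rw [List.getD_eq_default _ _ hi]
    exact isOn_nil n

theorem isOn_subst {ks : List GroupWord} (h : ∀ k ∈ ks, IsOn n k) (v : GroupWord) :
    IsOn n (subst ks v) := by
  intro p hp
  simp only [subst, List.mem_flatMap] at hp
  obtain ⟨q, -, hq⟩ := hp
  cases hb : q.2 <;> rw [hb] at hq
  · exact (isOn_getD h q.1).invRev p hq
  · exact isOn_getD h q.1 p hq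

end IsOn

section toFree

variable (n : ℕ)

@[simp] theorem toFree_nil : toFree n [] = 1 := by
  simp [toFree, ← FreeGroup.one_eq_mk]

@[simp] theorem toFree_append (u v : GroupWord) : toFree n (u ++ v) = toFree n u * toFree n v := by
  simp only [toFree, ← FreeGroup.mul_mk, map_mul]

@[simp] theorem toFree_invRev (u : GroupWord) : toFree n (FreeGroup.invRev u) = (toFree n u)⁻¹ := by
  simp only [toFree, ← FreeGroup.inv_mk, map_inv]

theorem toFree_cons (p : ℕ × Bool) (v : GroupWord) :
    toFree n (p :: v) = toFree n [p] * toFree n v := toFree_append n [p] v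

theorem toFree_letter (i : Fin n) : toFree n [((i : ℕ), true)] = FreeGroup.of i := by
  simp [toFree]

theorem toFree_letter_false (i : ℕ) : toFree n [(i, false)] = (toFree n [(i, true)])⁻¹ :=
  toFree_invRev n [(i, true)]

theorem toFree_getD_of_le {i : ℕ} (h : n ≤ i) : toFree n [(i, true)] = 1 := by
  simp [toFree, h]

theorem toFree_subst (ks : List GroupWord) (v : GroupWord) :
    toFree n (subst ks v) =
      FreeGroup.lift (fun i : Fin ks.length => toFree n (ks.get i)) (toFree ks.length v) := by
  -- Letters beyond the list are harmless: `getD` replaces them by the empty word and `toFree` sends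
  -- them to `1`, so `v` is arbitrary.
  have key (i : ℕ) : toFree n (ks.getD i []) =
      FreeGroup.lift (fun i : Fin ks.length => toFree n (ks.get i))
        (toFree ks.length [(i, true)]) := by
    rcases lt_or_ge i ks.length with hi | hi
    · rw [List.getD_eq_getElem _ _ hi, toFree_letter _ ⟨i, hi⟩]
      simp
    · rw [List.getD_eq_default _ _ hi, toFree_getD_of_le _ hi]
      simp
  induction v with
  | nil => simp [subst]
  | cons p v ih =>
    rw [toFree_cons, map_mul, ← ih]
    simp only [subst, List.flatMap_cons, toFree_append]
    congr 1
    obtain ⟨i, _ | _⟩ := p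
    · rw [toFree_letter_false, map_inv, ← key]
      exact toFree_invRev n _
    · rw [← key]
      rfl

theorem exists_toFree_eq (x : FreeGroup (Fin n)) : ∃ w : GroupWord, w.IsOn n ∧ toFree n w = x := by
  induction x using FreeGroup.induction_on with
  | C1 => exact ⟨[], isOn_nil n, toFree_nil n⟩
  | of i => exact ⟨[((i : ℕ), true)], by simp [IsOn], toFree_letter n i⟩
  | inv_of i _ => exact ⟨[((i : ℕ), false)], by simp [IsOn], by
      rw [toFree_letter_false, toFree_letter]⟩
  | mul x y hx hy =>
    obtain ⟨u, hu, rfl⟩ := hx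
    obtain ⟨v, hv, rfl⟩ := hy
    exact ⟨u ++ v, hu.append hv, toFree_append n u v⟩

variable {n}

/-- Passes to the free group on all of `ℕ`, where words of every rank live in one type. Without
`IsOn` it fails, since `toFree` kills other letters. -/
theorem map_toFree {w : GroupWord} (hw : w.IsOn n) :
    FreeGroup.map Fin.val (toFree n w) = FreeGroup.mk w := by
  induction w with
  | nil => simp [FreeGroup.one_eq_mk]
  | cons p v ih =>
    have hp : p.1 < n := hw p (by simp)
    rw [toFree_cons, map_mul, ih fun q hq => hw q (by simp [hq]), 
      show FreeGroup.mk (p :: v) = FreeGroup.mk [p] * FreeGroup.mk v from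
        (FreeGroup.mul_mk (L₁ := [p])).symm]
    congr 1
    obtain ⟨i, _ | _⟩ := p
    · rw [toFree_letter_false, toFree_letter n ⟨i, hp⟩]
      rfl
    · rw [toFree_letter n ⟨i, hp⟩]
      rfl

end toFree

section eval

variable {G : Type*} [Group G] {n : ℕ} (a : Fin n → G)

@[simp] theorem eval_nil : eval a [] = 1 := by simp [eval]

@[simp] theorem eval_append (u v : GroupWord) : eval a (u ++ v) = eval a u * eval a v := by
  simp [eval]

@[simp] theorem eval_invRev (u : GroupWord) : eval a (FreeGroup.invRev u) = (eval a u)⁻¹ := by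
  simp [eval]

theorem eval_cons (p : ℕ × Bool) (v : GroupWord) : eval a (p :: v) = eval a [p] * eval a v :=
  eval_append a [p] v

theorem eval_subst (ks : List GroupWord) (v : GroupWord) :
    eval a (subst ks v) = eval (fun i : Fin ks.length => (ks.get i).eval a) v := by
  simp only [eval, toFree_subst]
  generalize toFree ks.length v = x
  induction x using FreeGroup.induction_on <;> simp_all

theorem eval_map {H : Type*} [Group H] (φ : G →* H) (w : GroupWord) :
    eval (fun i => φ (a i)) w = φ (eval a w) := by
  simp only [eval]
  generalize toFree n w = x
  induction x using FreeGroup.induction_on <;> simp_all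

theorem exists_eval_eq {g : G} (hg : g ∈ Subgroup.closure (Set.range a)) :
    ∃ w : GroupWord, w.IsOn n ∧ w.eval a = g := by
  rw [← FreeGroup.range_lift_eq_closure] at hg
  obtain ⟨x, rfl⟩ := hg
  obtain ⟨w, hw, rfl⟩ := exists_toFree_eq n x
  exact ⟨w, hw, rfl⟩

end eval

/-! ### Consequences of relators -/

/-- The word `w` is a consequence of the relators `R`. -/
def IsConsequence (R : List GroupWord) (w : GroupWord) : Prop :=
  FreeGroup.mk w ∈ Subgroup.normalClosure {u : FreeGroup ℕ | ∃ r ∈ R, u = FreeGroup.mk r}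

/-- A product of conjugates of words and their inverses. -/
def conjProd (L : List (GroupWord × GroupWord × Bool)) : GroupWord :=
  L.flatMap fun t => t.1 ++ (bif t.2.2 then t.2.1 else FreeGroup.invRev t.2.1) ++
    FreeGroup.invRev t.1

/-- A normal closure consists of products of conjugates of generators and their inverses, and free
reduction decides equality in the free group. Thus `L` is a mechanically checkable certificate. -/
theorem isConsequence_iff (R : List GroupWord) (w : GroupWord) :
    IsConsequence R w ↔ ∃ L : List (GroupWord × GroupWord × Bool), (∀ t ∈ L, t.2.1 ∈ R) ∧
      FreeGroup.reduce w = FreeGroup.reduce (conjProd L) := by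
  have key (L) : FreeGroup.reduce w = FreeGroup.reduce (conjProd L) ↔
      FreeGroup.mk (conjProd L) = FreeGroup.mk w := by
    rw [← FreeGroup.toWord_mk, ← FreeGroup.toWord_mk, FreeGroup.toWord_inj, eq_comm]
  simp only [key]
  constructor
  · intro h
    unfold IsConsequence at h
    generalize FreeGroup.mk w = x at h ⊢
    induction h using Subgroup.closure_induction_left with
    | one => exact ⟨[], by simp, rfl⟩
    | mul_left x hx y _ ih =>
      obtain ⟨L, hL, rfl⟩ := ih
      obtain ⟨_, ⟨r, hr, rfl⟩, hc⟩ := Group.mem_conjugatesOfSet_iff.1 hx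
      obtain ⟨g, rfl⟩ := isConj_iff.1 hc
      obtain ⟨u, rfl⟩ := Quot.exists_rep g
      refine ⟨(u, r, true) :: L, List.forall_mem_cons.2 ⟨hr, hL⟩, ?_⟩
      change _ = FreeGroup.mk u * _ * (FreeGroup.mk u)⁻¹ * _
      simp [conjProd, ← FreeGroup.mul_mk, ← FreeGroup.inv_mk, mul_assoc]
    | inv_mul_cancel x hx y _ ih =>
      obtain ⟨L, hL, rfl⟩ := ih
      obtain ⟨_, ⟨r, hr, rfl⟩, hc⟩ := Group.mem_conjugatesOfSet_iff.1 hx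
      obtain ⟨g, rfl⟩ := isConj_iff.1 hc
      obtain ⟨u, rfl⟩ := Quot.exists_rep g
      refine ⟨(u, r, false) :: L, List.forall_mem_cons.2 ⟨hr, hL⟩, ?_⟩
      change _ = (FreeGroup.mk u * _ * (FreeGroup.mk u)⁻¹)⁻¹ * _
      simp [conjProd, ← FreeGroup.mul_mk, ← FreeGroup.inv_mk, mul_assoc]
  · rintro ⟨L, hL, h⟩
    rw [IsConsequence, ← h]
    clear h key
    induction L with
    | nil => exact one_mem _
    | cons t L ih =>
      have ht : FreeGroup.mk t.2.1 ∈
          Subgroup.normalClosure {u : FreeGroup ℕ | ∃ r ∈ R, u = FreeGroup.mk r} :=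
        Subgroup.subset_normalClosure ⟨_, hL t (by simp), rfl⟩
      rw [conjProd, List.flatMap_cons, ← FreeGroup.mul_mk]
      refine mul_mem ?_ (ih fun s hs => hL s (by simp [hs]))
      rw [← FreeGroup.mul_mk, ← FreeGroup.mul_mk, ← FreeGroup.inv_mk]
      refine Subgroup.normalClosure_normal.conj_mem _ ?_ _
      obtain ⟨u, r, _ | _⟩ := t
      · simpa [← FreeGroup.inv_mk] using ht
      · exact ht

theorem primrec_conjProd : Primrec conjProd := by
  have h₁ : Primrec fun x : List (GroupWord × GroupWord × Bool) × GroupWord × GroupWord × Bool =>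
      x.2.1 := Primrec.fst.comp Primrec.snd
  have h₂ : Primrec fun x : List (GroupWord × GroupWord × Bool) × GroupWord × GroupWord × Bool =>
      x.2.2.1 := Primrec.fst.comp (Primrec.snd.comp Primrec.snd)
  exact Primrec.list_flatMap Primrec.id (Primrec.list_append.comp (Primrec.list_append.comp h₁
    (Primrec.cond (Primrec.snd.comp (Primrec.snd.comp Primrec.snd)) h₂
      (FreeGroup.primrec_invRev.comp h₂))) (FreeGroup.primrec_invRev.comp h₁))

theorem semiDec_isConsequence :
    SemiDec fun x : List GroupWord × GroupWord => IsConsequence x.1 x.2 := by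
  refine SemiDec.of_iff (SemiDec.ex (PrimrecPred.semiDec ?_)) fun x => isConsequence_iff x.1 x.2
  refine PrimrecPred.and ?_ ?_
  · have : PrimrecRel fun (t : GroupWord × GroupWord × Bool) (R : List GroupWord) => t.2.1 ∈ R :=
      PrimrecRel.mem_list.comp (Primrec.fst.comp (Primrec.snd.comp Primrec.fst)) Primrec.snd
    exact (PrimrecRel.forall_mem_list this).comp Primrec.snd (Primrec.fst.comp Primrec.fst)
  · exact Primrec.eq.comp (FreeGroup.primrec_reduce.comp (Primrec.snd.comp Primrec.fst))
      (FreeGroup.primrec_reduce.comp (primrec_conjProd.comp Primrec.snd))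

end GroupWord

/-- The free group of rank `n` is a retract of that on `ℕ`: killing the letters from `n` on and
including the first `n` both carry relators to relators. -/
theorem IsPresentationOn.isConsequence_iff {G : Type*} [Group G] {n : ℕ} {a : Fin n → G}
    {R : List GroupWord} (h : IsPresentationOn a R) {w : GroupWord} (hw : w.IsOn n) :
    w.IsConsequence R ↔ w.eval a = 1 := by
  have h₁ : w.eval a = 1 ↔ w.toFree n ∈ (FreeGroup.lift a).ker := Iff.rfl
  rw [h₁, h.2]
  constructor
  · intro H
    refine Subgroup.normalClosure_le_normal (N := Subgroup.comap (FreeGroup.lift fun i : ℕ =>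
      if h : i < n then FreeGroup.of (⟨i, h⟩ : Fin n) else 1) (Subgroup.normalClosure _)) ?_ H
    rintro _ ⟨r, hr, rfl⟩
    exact Subgroup.subset_normalClosure ⟨r, hr, rfl⟩
  · intro H
    rw [GroupWord.IsConsequence, ← GroupWord.map_toFree hw]
    refine Subgroup.normalClosure_le_normal
      (N := Subgroup.comap (FreeGroup.map Fin.val) (Subgroup.normalClosure _)) ?_ H
    rintro _ ⟨r, hr, rfl⟩
    refine Subgroup.subset_normalClosure ⟨r, hr, ?_⟩
    exact GroupWord.map_toFree (h.1 r hr)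

/-! ### Finite presentability and coherence -/

open Subgroup in
/-- If the kernel of `φ` lies in the range of `β`, then it is normally generated by the images of
normal generators of the kernel of `φ ∘ β`. -/
theorem MonoidHom.ker_eq_normalClosure_image {A B C : Type*} [Group A] [Group B] [Group C]
    (β : A →* B) (φ : B →* C) (h : φ.ker ≤ β.range) {S : Set A}
    (hS : (φ.comp β).ker = normalClosure S) : φ.ker = normalClosure (β '' S) := by
  apply le_antisymm
  · intro x hx
    obtain ⟨y, rfl⟩ := h hx
    have hy : y ∈ normalClosure S := hS ▸ hx
    have : normalClosure S ≤ (normalClosure (β '' S)).comap β :=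
      normalClosure_le_normal fun s hs => subset_normalClosure (Set.mem_image_of_mem β hs)
    exact this hy
  · refine normalClosure_le_normal ?_
    rintro _ ⟨s, hs, rfl⟩
    have : s ∈ (φ.comp β).ker := hS ▸ subset_normalClosure hs
    exact this

open Subgroup in
/-- A finitely presented group has a finite presentation on every finite generating family. -/
theorem Group.IsFinitelyPresented.ker_lift_isFinitelyNormallyGenerated {K ι : Type*} [Group K]
    [Finite ι] [hK : Group.IsFinitelyPresented K] (ψ : FreeGroup ι →* K)
    (hψ : Function.Surjective ψ) : ψ.ker.IsFinitelyNormallyGenerated := by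
  obtain ⟨n, φ, hφ, S, hS, hker⟩ := hK.out
  choose α hα using fun i : Fin n => hψ (φ (FreeGroup.of i))
  choose β hβ using fun i : ι => hφ (ψ (FreeGroup.of i))
  have h₁ : ψ.comp (FreeGroup.lift α) = φ := FreeGroup.ext_hom _ _ fun i => by simp [hα]
  have h₂ : φ.comp (FreeGroup.lift β) = ψ := FreeGroup.ext_hom _ _ fun i => by simp [hβ]
  let θ := (FreeGroup.lift α).comp (FreeGroup.lift β)
  -- Tietze transformation: the old relators rewritten in the new generators, plus relations
  -- equating each new generator with its round trip `θ`.
  let T : Set (FreeGroup ι) := FreeGroup.lift α '' S ∪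
    Set.range fun i => FreeGroup.of i * (θ (FreeGroup.of i))⁻¹
  refine ⟨T, (hS.image _).union (Set.finite_range _), le_antisymm ?_ ?_⟩
  · refine normalClosure_le_normal (Set.union_subset ?_ ?_)
    · rintro _ ⟨s, hs, rfl⟩
      have : s ∈ φ.ker := hker ▸ subset_normalClosure hs
      rw [← h₁] at this
      exact this
    · rintro _ ⟨i, rfl⟩
      have : ψ (θ (FreeGroup.of i)) = ψ (FreeGroup.of i) := by
        conv_rhs => rw [← h₂, ← h₁]
        rfl
      simp [MonoidHom.mem_ker, this]
  · intro x hx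
    -- Modulo `T` the round trip is the identity, so it is enough to place `θ x` in the normal
    -- closure of `T`.
    have hθ : (QuotientGroup.mk' (normalClosure T)).comp θ = QuotientGroup.mk' _ := by
      refine FreeGroup.ext_hom _ _ fun i => ?_
      refine (QuotientGroup.eq_iff_div_mem.2 ?_).symm
      rw [div_eq_mul_inv]
      exact subset_normalClosure (Or.inr ⟨i, rfl⟩)
    have hx' : FreeGroup.lift β x ∈ normalClosure S := by
      rw [hker, MonoidHom.mem_ker, ← MonoidHom.comp_apply, h₂]
      exact hx
    have : normalClosure S ≤ (normalClosure T).comap (FreeGroup.lift α) :=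
      normalClosure_le_normal fun s hs =>
        subset_normalClosure (Or.inl (Set.mem_image_of_mem _ hs))
    have h₃ : θ x ∈ normalClosure T := this hx'
    have h₄ := DFunLike.congr_fun hθ x
    rw [← QuotientGroup.eq_one_iff] at h₃ ⊢
    exact h₄.symm.trans h₃

theorem IsCoherent.of_injective {G H : Type*} [Group G] [Group H] (hG : IsCoherent G)
    (φ : H →* G) (hφ : Function.Injective φ) : IsCoherent H := by
  intro K hK
  have : Group.FG K := (Group.fg_iff_subgroup_fg K).2 hK
  have : Group.FG (K.map φ) :=
    Group.fg_of_surjective (f := (K.equivMapOfInjective φ hφ : K →* K.map φ))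
      (K.equivMapOfInjective φ hφ).surjective
  have := hG (K.map φ) ((Group.fg_iff_subgroup_fg _).1 this)
  exact .equiv (K.equivMapOfInjective φ hφ).symm

theorem Subgroup.FG.exists_freeGroup_range {G : Type*} [Group G] {K : Subgroup G} (hK : K.FG) :
    ∃ (n : ℕ) (β : FreeGroup (Fin n) →* G), β.range = K := by
  obtain ⟨S, hS⟩ := hK
  refine ⟨S.card, FreeGroup.lift fun i => (S.equivFin.symm i : G), ?_⟩
  rw [FreeGroup.range_lift_eq_closure, ← hS]
  congr 1
  ext x
  simp only [Set.mem_range, SetLike.mem_coe]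
  constructor
  · rintro ⟨i, rfl⟩
    exact (S.equivFin.symm i).2
  · intro hx
    exact ⟨S.equivFin ⟨x, hx⟩, by simp⟩

theorem IsCoherent.of_finiteIndex {G : Type*} [Group G] (F : Subgroup G) [F.FiniteIndex]
    (hF : IsCoherent F) : IsCoherent G := by
  intro H hH
  obtain ⟨n, φ, rfl⟩ := hH.exists_freeGroup_range
  have hi : (F.comap φ).FiniteIndex := ⟨by
    rw [Subgroup.index_comap]
    exact (inferInstance : (F.subgroupOf φ.range).FiniteIndex).index_ne_zero⟩
  -- Schreier: a subgroup of finite index in a finitely generated group is finitely generated.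
  have hL : (F.comap φ).FG := (Group.fg_iff_subgroup_fg _).1 (Subgroup.fg_of_index_ne_zero _)
  obtain ⟨m, β, hβ⟩ := hL.exists_freeGroup_range
  have hmem (x : FreeGroup (Fin m)) : φ (β x) ∈ F := by
    have : β x ∈ F.comap φ := hβ ▸ ⟨x, rfl⟩
    exact this
  let ψ : FreeGroup (Fin m) →* F := (φ.comp β).codRestrict F hmem
  have hψ : Group.IsFinitelyPresented ψ.range := by
    refine hF _ ?_
    rw [← Group.fg_iff_subgroup_fg]
    infer_instance
  obtain ⟨S, hS, hker⟩ :=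
    hψ.ker_lift_isFinitelyNormallyGenerated ψ.rangeRestrict ψ.rangeRestrict_surjective
  have h : (φ.comp β).ker = Subgroup.normalClosure S := by
    rw [hker, MonoidHom.ker_rangeRestrict]
    ext x
    simp [ψ, MonoidHom.mem_ker]
  refine ⟨n, φ.rangeRestrict, φ.rangeRestrict_surjective, β '' S, hS.image _, ?_⟩
  rw [MonoidHom.ker_rangeRestrict, ← MonoidHom.ker_eq_normalClosure_image β φ ?_ h]
  rw [hβ]
  intro x hx
  rw [Subgroup.mem_comap, MonoidHom.mem_ker.1 hx]
  exact one_mem F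

theorem isCoherent_iff_of_finiteIndex {G : Type*} [Group G] (F : Subgroup G) [F.FiniteIndex] :
    IsCoherent F ↔ IsCoherent G :=
  ⟨.of_finiteIndex F, fun h => h.of_injective F.subtype F.subtype_injective⟩

/-! ### Permutation tables certifying non-membership -/

/-- The number to which the letter `p` takes the state `s`, according to the transition
table `tab`. -/
def tableStep (tab : List ℕ) (p : ℕ × Bool) (s : ℕ) : ℕ :=
  tab.getD (encode (p, s)) 0

/-- The state to which a word takes the state `s`. -/
def tableRun (tab : List ℕ) (w : GroupWord) (s : ℕ) : ℕ :=
  w.foldr (tableStep tab) s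

/-- The letters `x₀, …, xₙ₋₁` act through `tab` by permutations of `{0, …, m - 1}`, the relators
`R` act trivially, and the words `fs` fix `s` while `w` moves it. -/
def IsSeparatingTable (n : ℕ) (R fs : List GroupWord) (w : GroupWord) (tab : List ℕ) (m s : ℕ) :
    Prop :=
  s < m ∧
  (∀ i ∈ List.range n, ∀ b ∈ [true, false], ∀ x ∈ List.range m, tableStep tab (i, b) x < m ∧
    tableStep tab (i, !b) (tableStep tab (i, b) x) = x) ∧
  (∀ r ∈ R, ∀ x ∈ List.range m, tableRun tab r x = x) ∧
  (∀ f ∈ fs, tableRun tab f s = s) ∧ tableRun tab w s ≠ s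

section SemiDec

variable {α : Type*} [Primcodable α]

theorem Primrec.tableStep {t : α → List ℕ} {p : α → ℕ × Bool} {x : α → ℕ} (ht : Primrec t)
    (hp : Primrec p) (hx : Primrec x) : Primrec fun a => tableStep (t a) (p a) (x a) :=
  (Primrec.list_getD 0).comp ht (Primrec.encode.comp (hp.pair hx))

theorem Primrec.tableRun {t : α → List ℕ} {w : α → GroupWord} {x : α → ℕ} (ht : Primrec t)
    (hw : Primrec w) (hx : Primrec x) : Primrec fun a => tableRun (t a) (w a) (x a) :=
  Primrec.list_foldr (h := fun a (p : (ℕ × Bool) × ℕ) => _root_.tableStep (t a) p.1 p.2) hw hx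
    (.tableStep (ht.comp .fst) (Primrec.fst.comp .snd) (Primrec.snd.comp .snd))

theorem SemiDec.isSeparatingTable {n m s : α → ℕ} {R fs : α → List GroupWord} {w : α → GroupWord}
    {tab : α → List ℕ} (hn : Primrec n) (hR : Primrec R) (hfs : Primrec fs) (hw : Primrec w)
    (ht : Primrec tab) (hm : Primrec m) (hs : Primrec s) :
    SemiDec fun a => IsSeparatingTable (n a) (R a) (fs a) (w a) (tab a) (m a) (s a) := by
  have h₁ : SemiDec fun x : ((α × ℕ) × Bool) × ℕ =>
      tableStep (tab x.1.1.1) (x.1.1.2, x.1.2) x.2 < m x.1.1.1 ∧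
      tableStep (tab x.1.1.1) (x.1.1.2, !x.1.2)
        (tableStep (tab x.1.1.1) (x.1.1.2, x.1.2) x.2) = x.2 := by
    have ha : Primrec fun x : ((α × ℕ) × Bool) × ℕ => x.1.1.1 := .comp .fst (.comp .fst .fst)
    have hi : Primrec fun x : ((α × ℕ) × Bool) × ℕ => x.1.1.2 := .comp .snd (.comp .fst .fst)
    have hb : Primrec fun x : ((α × ℕ) × Bool) × ℕ => x.1.2 := .comp .snd .fst
    have h := Primrec.tableStep (ht.comp ha) (hi.pair hb) .snd
    exact ((Primrec.nat_lt.comp h (hm.comp ha)).and (Primrec.eq.comp (.tableStep (ht.comp ha)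
      (hi.pair (Primrec.not.comp hb)) h) .snd)).semiDec
  have h₂ : SemiDec fun x : (α × GroupWord) × ℕ => tableRun (tab x.1.1) x.1.2 x.2 = x.2 :=
    (Primrec.eq.comp (.tableRun (ht.comp (.comp .fst .fst)) (.comp .snd .fst) .snd) .snd).semiDec
  have h₃ : SemiDec fun x : α × GroupWord => tableRun (tab x.1) x.2 (s x.1) = s x.1 :=
    (Primrec.eq.comp (.tableRun (ht.comp .fst) .snd (hs.comp .fst)) (hs.comp .fst)).semiDec
  have h₄ : SemiDec fun a => tableRun (tab a) (w a) (s a) ≠ s a :=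
    (Primrec.eq.comp (.tableRun ht hw hs) hs).not.semiDec
  exact (Primrec.nat_lt.comp hs hm).semiDec.and <|
    .and (.all_mem (.comp .list_range hn) (.all_mem (.const _)
      (.all_mem (.comp .list_range (hm.comp (.comp .fst .fst))) h₁))) <|
    .and (.all_mem hR (.all_mem (.comp .list_range (hm.comp .fst)) h₂)) <|
    .and (.all_mem hfs h₃) h₄

theorem SemiDec.isConsequence {R : α → List GroupWord} {w : α → GroupWord} (hR : Primrec R)
    (hw : Primrec w) : SemiDec fun a => IsConsequence (R a) (w a) :=
  SemiDec.comp (p := fun x : List GroupWord × GroupWord => IsConsequence x.1 x.2)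
    (f := fun a => (R a, w a)) semiDec_isConsequence (hR.pair hw)

end SemiDec

/-- Only finitely many entries of a transition table matter, so a coset action can be stored as a
list. -/
theorem exists_list_getD_eq (f : ℕ → ℕ) (D : Finset ℕ) :
    ∃ tab : List ℕ, ∀ k ∈ D, tab.getD k 0 = f k := by
  refine ⟨(List.range (D.sup id + 1)).map f, fun k hk => ?_⟩
  have : k < D.sup id + 1 := Nat.lt_succ_of_le (Finset.le_sup (f := id) hk)
  rw [List.getD_eq_getElem _ _ (by simpa using this)]
  simp

/-- A separating table yields a permutation representation of the free group. -/
theorem IsSeparatingTable.exists_hom {n : ℕ} {R fs : List GroupWord} {w : GroupWord} {tab : List ℕ}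
    {m s : ℕ} (h : IsSeparatingTable n R fs w tab m s) :
    ∃ ψ : FreeGroup (Fin n) →* Equiv.Perm (Fin m), ∀ (v : GroupWord), v.IsOn n → ∀ x : Fin m,
      (ψ (v.toFree n) x : ℕ) = tableRun tab v x := by
  have hstep (i : Fin n) (b : Bool) (x : Fin m) : tableStep tab (i, b) x < m ∧
      tableStep tab (i, !b) (tableStep tab (i, b) x) = x :=
    h.2.1 i (by simp) b (by cases b <;> simp) x (by simp)
  let π (i : Fin n) : Equiv.Perm (Fin m) :=
    { toFun := fun x => ⟨tableStep tab (i, true) x, (hstep i true x).1⟩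
      invFun := fun x => ⟨tableStep tab (i, false) x, (hstep i false x).1⟩
      left_inv := fun x => Fin.ext (hstep i true x).2
      right_inv := fun x => Fin.ext (hstep i false x).2 }
  refine ⟨FreeGroup.lift π, fun v => ?_⟩
  induction v with
  | nil => simp [tableRun]
  | cons p v ih =>
    intro hv x
    have hp : p.1 < n := hv p (by simp)
    have ih := ih (fun q hq => hv q (by simp [hq])) x
    -- The right fold applies the last letter first, as composition of permutations does.
    rw [toFree_cons, map_mul, Equiv.Perm.mul_apply, tableRun, List.foldr_cons]
    obtain ⟨i, _ | _⟩ := p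
    · rw [toFree_letter_false, toFree_letter n ⟨i, hp⟩, map_inv, FreeGroup.lift_apply_of]
      exact congrArg (tableStep tab (i, false)) ih
    · rw [toFree_letter n ⟨i, hp⟩, FreeGroup.lift_apply_of]
      exact congrArg (tableStep tab (i, true)) ih

section

variable {G : Type*} [Group G] {F : Subgroup G} {n : ℕ} {a : Fin n → G} {R fs : List GroupWord}
  {f : Fin fs.length → F}

theorem GeneratesVia.coe_eval (hf : GeneratesVia a F fs f) (v : GroupWord) :
    ((v.eval f : F) : G) = (subst fs v).eval a := by
  rw [eval_subst, ← F.coe_subtype, ← eval_map]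
  congr 1
  funext i
  exact hf.2.1 i

theorem GeneratesVia.eval_mem_iff (hf : GeneratesVia a F fs f) (w : GroupWord) :
    w.eval a ∈ F ↔ ∃ v : GroupWord, v.IsOn fs.length ∧ (subst fs v).eval a = w.eval a := by
  constructor
  · intro h
    obtain ⟨v, hv, hvw⟩ := exists_eval_eq f (g := ⟨_, h⟩) (by rw [hf.2.2]; trivial)
    exact ⟨v, hv, by rw [← hf.coe_eval, hvw]⟩
  · rintro ⟨v, -, hv⟩
    rw [← hv, ← hf.coe_eval]
    exact SetLike.coe_mem _

theorem Presents.isConsequence_append_invRev (hR : Presents a R) {u v : GroupWord}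
    (hu : u.IsOn n) (hv : v.IsOn n) :
    IsConsequence R (u ++ FreeGroup.invRev v) ↔ v.eval a = u.eval a := by
  rw [hR.2.isConsequence_iff (hu.append hv.invRev), eval_append, eval_invRev, mul_inv_eq_one,
    eq_comm]

/-- The relators act trivially, so the action depends only on the element of `G`. The generators of
`F` fix `s`, hence so does all of `F`, while `w` moves it. -/
theorem IsSeparatingTable.not_mem (hR : Presents a R) (hf : GeneratesVia a F fs f) {w : GroupWord}
    (hw : w.IsOn n) {tab : List ℕ} {m s : ℕ} (h : IsSeparatingTable n R fs w tab m s) :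
    w.eval a ∉ F := by
  obtain ⟨ψ, hψ⟩ := h.exists_hom
  obtain ⟨hs, -, hrel, hgen, hmove⟩ := h
  have hker : (FreeGroup.lift a).ker ≤ ψ.ker := by
    rw [hR.2.2]
    refine Subgroup.normalClosure_le_normal ?_
    rintro _ ⟨r, hr, rfl⟩
    ext x
    rw [hψ r (hR.2.1 r hr), hrel r hr x (by simp)]
    rfl
  intro hF
  obtain ⟨v, hv, hvw⟩ := (hf.eval_mem_iff w).1 hF
  have hfix : toFree n (subst fs v) ∈
      (MulAction.stabilizer (Equiv.Perm (Fin m)) (⟨s, hs⟩ : Fin m)).comap ψ := by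
    rw [toFree_subst]
    generalize toFree fs.length v = y
    set β := FreeGroup.lift fun i : Fin fs.length => toFree n (fs.get i)
    induction y using FreeGroup.induction_on with
    | C1 => exact map_one β ▸ one_mem _
    | of i =>
      rw [show β (FreeGroup.of i) = _ from FreeGroup.lift_apply_of]
      exact Fin.ext ((hψ _ (hf.1 _ (List.get_mem ..)) _).trans (hgen _ (List.get_mem ..)))
    | inv_of i hi => exact map_inv β _ ▸ inv_mem hi
    | mul x y hx hy => exact map_mul β _ _ ▸ mul_mem hx hy
  have hmem : toFree n w * (toFree n (subst fs v))⁻¹ ∈ (FreeGroup.lift a).ker := by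
    rw [MonoidHom.mem_ker, map_mul, map_inv, mul_inv_eq_one]
    exact hvw.symm
  have heq : ψ (toFree n w) = ψ (toFree n (subst fs v)) := by
    simpa [mul_inv_eq_one] using hker hmem
  refine hmove ((hψ w hw ⟨s, hs⟩).symm.trans ?_)
  rw [heq]
  exact congrArg Fin.val hfix

/-- The table records left multiplication on `G ⧸ F`, numbered by `e`; the point `s` is the trivial
coset, whose stabilizer is `F`. -/
theorem exists_isSeparatingTable [F.FiniteIndex] (hR : Presents a R) (hf : GeneratesVia a F fs f)
    {w : GroupWord} (hw : w.IsOn n) (h : w.eval a ∉ F) :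
    ∃ tab m s, IsSeparatingTable n R fs w tab m s := by
  obtain ⟨m, ⟨e⟩⟩ := Finite.exists_equiv_fin (G ⧸ F)
  let g : ((ℕ × Bool) × ℕ) → ℕ := fun x =>
    if hx : x.2 < m then e (eval a [x.1] • e.symm ⟨x.2, hx⟩) else 0
  obtain ⟨tab, htab⟩ := exists_list_getD_eq
    (fun k => ((decode (α := (ℕ × Bool) × ℕ) k).map g).getD 0)
    (((Finset.range n ×ˢ (Finset.univ : Finset Bool)) ×ˢ Finset.range m).image encode)
  have hstep {p : ℕ × Bool} (hp : p.1 < n) (x : G ⧸ F) :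
      tableStep tab p (e x) = e (eval a [p] • x) := by
    rw [tableStep, htab _ (Finset.mem_image_of_mem _ (by simp [hp]))]
    simp [g]
  have hrun {v : GroupWord} (hv : v.IsOn n) (x : G ⧸ F) :
      tableRun tab v (e x) = e (eval a v • x) := by
    induction v with
    | nil => simp [tableRun]
    | cons p v ih =>
      rw [tableRun, List.foldr_cons, eval_cons, mul_smul, ← hstep (hv p (by simp)),
        ← ih fun q hq => hv q (by simp [hq]), tableRun]
  have hcoe (x : ℕ) (hx : x ∈ List.range m) : x = e (e.symm ⟨x, by simpa using hx⟩) := by simp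
  refine ⟨tab, m, e ((1 : G) : G ⧸ F), Fin.is_lt _, fun i hi b _ x hx => ?_, fun r hr x hx => ?_,
    fun u hu => ?_, ?_⟩
  · have hi : i < n := by simpa using hi
    rw [hcoe x hx, hstep hi, hstep hi]
    refine ⟨Fin.is_lt _, ?_⟩
    have : eval a [(i, !b)] = (eval a [(i, b)])⁻¹ := eval_invRev a [(i, b)]
    rw [this, inv_smul_smul]
  · rw [hcoe x hx, hrun (hR.2.1 r hr),
      (hR.2.isConsequence_iff (hR.2.1 r hr)).1 (Subgroup.subset_normalClosure ⟨r, hr, rfl⟩),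
      one_smul]
  · rw [hrun (hf.1 u hu)]
    congr 2
    obtain ⟨i, rfl⟩ := List.get_of_mem hu
    rw [← hf.2.1 i]
    change ((_ * 1 : G) : G ⧸ F) = _
    rw [QuotientGroup.eq]
    simp
  · rw [hrun hw]
    intro heq
    have : ((eval a w * 1 : G) : G ⧸ F) = ((1 : G) : G ⧸ F) := e.injective (Fin.ext heq)
    rw [QuotientGroup.eq] at this
    exact h (by simpa using this)

end

/-! ### Decidability of membership -/

/-- Membership in a subgroup of finite index of a finitely presented group is decidable, uniformly
in the presentation and in generators of the subgroup. -/
theorem exists_membership_code :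
    ∃ memb : ℕ × List GroupWord × List GroupWord → Nat.Partrec.Code, Computable memb ∧
      ∀ (G : Type u) [Group G] (F : Subgroup G) [F.FiniteIndex]
        (n : ℕ) (a : Fin n → G) (R : List GroupWord), Presents a R →
        ∀ (fs : List GroupWord) (f : Fin fs.length → F), GeneratesVia a F fs f →
          DecidesMembership (memb (n, R, fs)) a F := by
  -- Two searches compete: a spelling of the word in the generators of `F` certifies `true`, a
  -- separating table certifies `false`.
  have h : SemiDec fun x : ((ℕ × List GroupWord × List GroupWord) × GroupWord) × Bool =>
      (x.2 = true ∧ ∃ v : GroupWord,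
        IsConsequence x.1.1.2.1 (x.1.2 ++ FreeGroup.invRev (subst x.1.1.2.2 v))) ∨
      (x.2 = false ∧ ∃ t : List ℕ × ℕ × ℕ,
        IsSeparatingTable x.1.1.1 x.1.1.2.1 x.1.1.2.2 x.1.2 t.1 t.2.1 t.2.2) := by
    let P := ((ℕ × List GroupWord × List GroupWord) × GroupWord) × Bool
    have hw : Primrec fun x : P => x.1.2 := .comp .snd .fst
    have hn : Primrec fun x : P => x.1.1.1 := .comp .fst (.comp .fst .fst)
    have hR : Primrec fun x : P => x.1.1.2.1 := .comp .fst (.comp .snd (.comp .fst .fst))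
    have hfs : Primrec fun x : P => x.1.1.2.2 := .comp .snd (.comp .snd (.comp .fst .fst))
    refine .or (.and (Primrec.eq.comp .snd (.const true)).semiDec (.ex ?_))
      (.and (Primrec.eq.comp .snd (.const false)).semiDec (.ex ?_))
    · exact .isConsequence (hR.comp .fst) (Primrec.list_append.comp (hw.comp .fst)
        (FreeGroup.primrec_invRev.comp (primrec_subst.comp (hfs.comp .fst) .snd)))
    · exact .isSeparatingTable (hn.comp .fst) (hR.comp .fst) (hfs.comp .fst) (hw.comp .fst)
        (.comp .fst .snd) (.comp .fst (.comp .snd .snd)) (.comp .snd (.comp .snd .snd))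
  obtain ⟨memb, hmemb, H⟩ := h.exists_code
  refine ⟨memb, hmemb, fun G _ F _ n a R hR fs f hf w hw => ?_⟩
  obtain ⟨b, hb, hb'⟩ := H (n, R, fs) w <| by
    by_cases hF : w.eval a ∈ F
    · obtain ⟨v, -, hv⟩ := (hf.eval_mem_iff w).1 hF
      exact ⟨true, .inl ⟨rfl, v,
        (hR.isConsequence_append_invRev hw (isOn_subst hf.1 v)).2 hv⟩⟩
    · obtain ⟨tab, m, s, h⟩ := exists_isSeparatingTable hR hf hw hF
      exact ⟨false, .inr ⟨rfl, (tab, m, s), h⟩⟩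
  refine ⟨b, hb, ?_⟩
  rcases hb' with ⟨rfl, v, hv⟩ | ⟨rfl, t, ht⟩
  · have hv := (hR.isConsequence_append_invRev hw (isOn_subst hf.1 v)).1 hv
    simp only [true_iff]
    rw [← hv, ← hf.coe_eval]
    exact SetLike.coe_mem _
  · simpa using ht.not_mem hR hf hw

/-! ### Preimages of the subgroup in free groups -/

/-- An injective homomorphism does not change the kernel, so relators pass between `F` and `G`. The
cast absorbs list lengths that agree only propositionally. -/
theorem IsPresentationOn.congr {G H : Type*} [Group G] [Group H] {r s : ℕ} {g : Fin r → G}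
    {h : Fin s → H} {rels : List GroupWord} (φ : G →* H) (hφ : Function.Injective φ) (e : r = s)
    (hgh : ∀ i, h (Fin.cast e i) = φ (g i)) :
    IsPresentationOn g rels ↔ IsPresentationOn h rels := by
  subst e
  have : FreeGroup.lift h = φ.comp (FreeGroup.lift g) :=
    FreeGroup.ext_hom _ _ fun i => by simpa using hgh i
  have : (FreeGroup.lift h).ker = (FreeGroup.lift g).ker := by
    ext x
    simp [this, MonoidHom.mem_ker, map_eq_one_iff φ hφ]
  rw [IsPresentationOn, IsPresentationOn, this]

section

variable {G : Type*} [Group G] {F : Subgroup G} {n : ℕ} {a : Fin n → G}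

/-- The words `ks` are found, by means of the membership algorithm `m`, to generate the preimage of
a subgroup in the free group on as many letters as there are words in `hs`; these words spell
the images of the letters. The words `T` represent the cosets of the preimage. -/
def FindsPreimage (m : Nat.Partrec.Code) (hs ks T : List GroupWord) : Prop :=
  [] ∈ T ∧
  (∀ k ∈ ks, k.IsOn hs.length ∧ encode true ∈ m.eval (encode (subst hs k))) ∧
  (∀ t ∈ T, ∀ i ∈ List.range hs.length, ∀ b ∈ [true, false], ∃ t' ∈ T,
    t ++ [(i, b)] ++ FreeGroup.invRev t' ∈ ks) ∧
  ∀ t ∈ T, t ∈ ks ∨ encode false ∈ m.eval (encode (subst hs t))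

theorem DecidesMembership.true_mem_eval_iff {m : Nat.Partrec.Code} (hm : DecidesMembership m a F)
    {w : GroupWord} (hw : w.IsOn n) : encode true ∈ m.eval (encode w) ↔ w.eval a ∈ F := by
  obtain ⟨b, hb, h⟩ := hm w hw
  rw [← h]
  constructor
  · intro h'
    exact encode_injective (Part.mem_unique hb h')
  · rintro rfl
    exact hb

theorem DecidesMembership.false_mem_eval_iff {m : Nat.Partrec.Code} (hm : DecidesMembership m a F)
    {w : GroupWord} (hw : w.IsOn n) : encode false ∈ m.eval (encode w) ↔ w.eval a ∉ F := by
  obtain ⟨b, hb, h⟩ := hm w hw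
  rw [← h, Bool.not_eq_true]
  constructor
  · intro h'
    exact encode_injective (Part.mem_unique hb h')
  · rintro rfl
    exact hb

/-- Coset tracing: reading a word letter by letter shows that it lies in `L * t` for some `t ∈ T`.
If the word is in the preimage, so is `t`; then `t ∈ ks`, and the word lies in `L`. `T` may contain
several representatives of a coset. -/
theorem FindsPreimage.range_eq {m : Nat.Partrec.Code} (hm : DecidesMembership m a F)
    {hs ks T : List GroupWord} (hhs : ∀ h ∈ hs, h.IsOn n) (h : FindsPreimage m hs ks T) :
    (FreeGroup.lift fun i : Fin ks.length => toFree hs.length (ks.get i)).range =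
      F.comap (FreeGroup.lift fun i : Fin hs.length => (hs.get i).eval a) := by
  obtain ⟨hnil, hks, hT, hTF⟩ := h
  have hmem (w : GroupWord) : toFree hs.length w ∈
      F.comap (FreeGroup.lift fun i : Fin hs.length => (hs.get i).eval a) ↔
        (subst hs w).eval a ∈ F := by
    rw [eval_subst]
    rfl
  rw [FreeGroup.range_lift_eq_closure]
  set L := Subgroup.closure (Set.range fun i : Fin ks.length => toFree hs.length (ks.get i))
  have hL {k : GroupWord} (hk : k ∈ ks) : toFree hs.length k ∈ L := by
    obtain ⟨i, rfl⟩ := List.get_of_mem hk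
    exact Subgroup.subset_closure ⟨i, rfl⟩
  have hLF : L ≤ F.comap (FreeGroup.lift fun i : Fin hs.length => (hs.get i).eval a) := by
    refine (Subgroup.closure_le _).2 ?_
    rintro _ ⟨i, rfl⟩
    exact (hmem _).2
      ((hm.true_mem_eval_iff (isOn_subst hhs _)).1 (hks _ (List.get_mem ..)).2)
  refine le_antisymm hLF fun x hx => ?_
  have key (w : GroupWord) (hw : w.IsOn hs.length) :
      ∃ t ∈ T, toFree hs.length (w ++ FreeGroup.invRev t) ∈ L := by
    induction w using List.reverseRecOn with
    | nil => exact ⟨[], hnil, by simp⟩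
    | append_singleton w p ih =>
      obtain ⟨hw, hp⟩ := isOn_append.1 hw
      obtain ⟨t, ht, hwt⟩ := ih hw
      obtain ⟨t', ht', hk⟩ := hT t ht p.1 (by simpa using hp p (by simp)) p.2
        (by cases p.2 <;> simp)
      refine ⟨t', ht', ?_⟩
      simpa [mul_assoc] using mul_mem hwt (hL hk)
  obtain ⟨w, hw, rfl⟩ := exists_toFree_eq _ x
  obtain ⟨t, ht, hwt⟩ := key w hw
  have hwt' : toFree hs.length w * (toFree hs.length t)⁻¹ ∈ L := by simpa using hwt
  have htF : (subst hs t).eval a ∈ F := by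
    rw [← hmem]
    have := mul_mem (inv_mem (hLF hwt')) hx
    simpa using this
  have : t ∈ ks := (hTF t ht).resolve_right fun h =>
    (hm.false_mem_eval_iff (isOn_subst hhs t)).1 h htF
  simpa using mul_mem hwt' (hL this)

theorem exists_findsPreimage [F.FiniteIndex] {m : Nat.Partrec.Code} (hm : DecidesMembership m a F)
    {hs : List GroupWord} (hhs : ∀ h ∈ hs, h.IsOn n) : ∃ ks T, FindsPreimage m hs ks T := by
  classical
  -- `G ⧸ F` consists of left cosets; the inverse turns them into the right cosets that are needed
  -- here.
  let c : {w : GroupWord // w.IsOn hs.length} → G ⧸ F := fun w =>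
    QuotientGroup.mk ((subst hs w).eval a)⁻¹
  obtain ⟨T₀, hT₀⟩ : ∃ T₀ : List GroupWord, (∀ t ∈ T₀, t.IsOn hs.length) ∧
      ∀ w : GroupWord, w.IsOn hs.length → ∃ t ∈ T₀,
        (subst hs (w ++ FreeGroup.invRev t)).eval a ∈ F := by
    choose g hg using fun y : Set.range c => y.2
    have := Fintype.ofFinite (Set.range c)
    refine ⟨(Finset.univ.toList.map g).map Subtype.val, ?_, fun w hw => ?_⟩
    · intro t ht
      obtain ⟨t, -, rfl⟩ := List.mem_map.1 ht
      exact t.2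
    · refine ⟨g ⟨c ⟨w, hw⟩, ⟨w, hw⟩, rfl⟩, by simp, ?_⟩
      have := hg ⟨c ⟨w, hw⟩, ⟨w, hw⟩, rfl⟩
      have := QuotientGroup.eq.1 this.symm
      simpa [eval_subst] using this
  let T : List GroupWord := [] :: T₀
  have hTon : ∀ t ∈ T, t.IsOn hs.length := List.forall_mem_cons.2 ⟨isOn_nil _, hT₀.1⟩
  let A : List GroupWord := T.flatMap fun t => (List.range hs.length).flatMap fun i =>
    [true, false].flatMap fun b => T.map fun t' => t ++ [(i, b)] ++ FreeGroup.invRev t'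
  have hAon : ∀ k ∈ A, k.IsOn hs.length := by
    intro k hk
    simp only [A, List.mem_flatMap, List.mem_map, List.mem_range] at hk
    obtain ⟨t, ht, i, hi, b, -, t', ht', rfl⟩ := hk
    exact ((hTon t ht).append (by simpa [IsOn] using hi)).append (hTon t' ht').invRev
  have hATon : ∀ k ∈ A ++ T, k.IsOn hs.length := fun k hk =>
    (List.mem_append.1 hk).elim (hAon k) (hTon k)
  -- Keep the Schreier words `t xᵢ^±1 t'⁻¹` and the representatives that land in `F`. Retaining all
  -- of them is redundant but meets every condition.
  refine ⟨(A ++ T).filter fun k => (subst hs k).eval a ∈ F, T, by simp [T], fun k hk => ?_,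
    fun t ht i hi b hb => ?_, fun t ht => ?_⟩
  · rw [List.mem_filter, decide_eq_true_iff] at hk
    exact ⟨hATon k hk.1, (hm.true_mem_eval_iff (isOn_subst hhs k)).2 hk.2⟩
  · obtain ⟨t', ht', h⟩ := hT₀.2 (t ++ [(i, b)])
      ((hTon t ht).append (by simpa [IsOn] using hi))
    refine ⟨t', List.mem_cons_of_mem _ ht', List.mem_filter.2 ⟨List.mem_append_left _ ?_, by
      simpa using h⟩⟩
    simp only [A, List.mem_flatMap, List.mem_map]
    exact ⟨t, ht, i, hi, b, hb, t', List.mem_cons_of_mem _ ht', rfl⟩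
  · rw [List.mem_filter, decide_eq_true_iff, hm.false_mem_eval_iff (isOn_subst hhs t)]
    by_cases h : (subst hs t).eval a ∈ F
    · exact .inl ⟨List.mem_append_right _ ht, h⟩
    · exact .inr h

theorem exists_generatesVia {fs : List GroupWord} (hfs : ∀ w ∈ fs, w.IsOn n)
    (h : Subgroup.closure (Set.range fun i : Fin fs.length => (fs.get i).eval a) = F) :
    ∃ f : Fin fs.length → F, GeneratesVia a F fs f := by
  have hmem (i : Fin fs.length) : (fs.get i).eval a ∈ F :=
    h ▸ Subgroup.subset_closure ⟨i, rfl⟩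
  refine ⟨fun i => ⟨_, hmem i⟩, hfs, fun i => rfl, ?_⟩
  apply Subgroup.map_injective F.subtype_injective
  rw [MonoidHom.map_closure, ← Set.range_comp, ← MonoidHom.range_eq_map, Subgroup.range_subtype]
  exact h

/-- The words `xᵢ` for the letters `x₀, …, xₙ₋₁`. -/
def letters (n : ℕ) : List GroupWord :=
  (List.range n).map fun i => [(i, true)]

theorem primrec_letters : Primrec letters :=
  Primrec.list_map Primrec.list_range
    (Primrec.list_cons.comp (Primrec.snd.pair (.const true)) (.const []))

theorem isOn_of_mem_letters {w : GroupWord} (hw : w ∈ letters n) : w.IsOn n := by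
  simp only [letters, List.mem_map, List.mem_range] at hw
  obtain ⟨i, hi, rfl⟩ := hw
  simpa [IsOn] using hi

theorem lift_letters_surjective (ha : Subgroup.closure (Set.range a) = ⊤) :
    Function.Surjective
      (FreeGroup.lift fun i : Fin (letters n).length => ((letters n).get i).eval a) := by
  rw [← MonoidHom.range_eq_top, FreeGroup.range_lift_eq_closure, eq_top_iff, ← ha]
  refine Subgroup.closure_mono ?_
  rintro _ ⟨i, rfl⟩
  refine ⟨⟨i, by simp [letters]⟩, ?_⟩
  simp [letters, eval, toFree_letter]

/-- With the letters themselves as `hs` the free group maps onto `G`, so the image of the preimage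
of `F` is `F`. -/
theorem FindsPreimage.exists_generatesVia {m : Nat.Partrec.Code} (hm : DecidesMembership m a F)
    (ha : Subgroup.closure (Set.range a) = ⊤) {ks T : List GroupWord}
    (h : FindsPreimage m (letters n) ks T) :
    ∃ f : Fin (ks.map (subst (letters n))).length → F,
      GeneratesVia a F (ks.map (subst (letters n))) f := by
  have hon : ∀ h ∈ letters n, h.IsOn n := fun h => isOn_of_mem_letters
  refine _root_.exists_generatesVia ?_ ?_
  · intro w hw
    obtain ⟨k, -, rfl⟩ := List.mem_map.1 hw
    exact isOn_subst hon k
  · have := congrArg (Subgroup.map (FreeGroup.lift fun i : Fin (letters n).length =>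
      ((letters n).get i).eval a)) (h.range_eq hm hon)
    rw [Subgroup.map_comap_eq_self_of_surjective (lift_letters_surjective ha),
      FreeGroup.range_lift_eq_closure, MonoidHom.map_closure, ← Set.range_comp] at this
    rw [← this]
    congr 1
    ext x
    simp only [Set.mem_range, Fin.exists_iff, List.length_map, List.get_eq_getElem,
      List.getElem_map, eval_subst, Function.comp_apply]
    rfl

/-- The transfer of kernels along `β`, on words: `β` sends the letters to `ks`, so substituting `ks`
computes it. -/
theorem FindsPreimage.isPresentationOn {m : Nat.Partrec.Code} (hm : DecidesMembership m a F)
    {hs ks T : List GroupWord} (hhs : ∀ h ∈ hs, h.IsOn n) (h : FindsPreimage m hs ks T)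
    {S : List GroupWord} (hS : IsPresentationOn
      (fun i : Fin (ks.map (subst hs)).length => ((ks.map (subst hs)).get i).eval a) S) :
    IsPresentationOn (fun i : Fin hs.length => (hs.get i).eval a) (S.map (subst ks)) := by
  have hS' : IsPresentationOn (fun i : Fin ks.length =>
      (FreeGroup.lift fun i : Fin hs.length => (hs.get i).eval a) (toFree hs.length (ks.get i)))
      S := by
    refine (IsPresentationOn.congr (MonoidHom.id G) Function.injective_id (by simp) ?_).2 hS
    intro i
    simp [eval_subst]
    rfl
  refine ⟨?_, ?_⟩
  · intro w hw
    obtain ⟨s, -, rfl⟩ := List.mem_map.1 hw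
    exact isOn_subst (fun k hk => (h.2.1 k hk).1) s
  · rw [MonoidHom.ker_eq_normalClosure_image
      (FreeGroup.lift fun i : Fin ks.length => toFree hs.length (ks.get i)) _
      (S := {u | ∃ w ∈ S, u = w.toFree ks.length}) ?_ ?_]
    · congr 1
      ext x
      simp only [Set.mem_image, Set.mem_ofPred_eq, List.mem_map]
      constructor
      · rintro ⟨_, ⟨w, hw, rfl⟩, rfl⟩
        exact ⟨_, ⟨w, hw, rfl⟩, (toFree_subst _ _ _).symm⟩
      · rintro ⟨_, ⟨w, hw, rfl⟩, rfl⟩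
        exact ⟨_, ⟨w, hw, rfl⟩, (toFree_subst _ _ _).symm⟩
    · rw [h.range_eq hm hhs]
      intro x hx
      rw [Subgroup.mem_comap, MonoidHom.mem_ker.1 hx]
      exact one_mem F
    · rw [← hS'.2]
      congr 1
      exact FreeGroup.ext_hom _ _ fun i => by simp

end

section SemiDec

variable {α : Type*} [Primcodable α]

theorem SemiDec.findsPreimage {m : α → Nat.Partrec.Code} {hs ks T : α → List GroupWord}
    (hm : Primrec m) (hhs : Primrec hs) (hks : Primrec ks) (hT : Primrec T) :
    SemiDec fun a => FindsPreimage (m a) (hs a) (ks a) (T a) := by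
  have mem {f : α × GroupWord → GroupWord} (hf : Primrec f) (b : Bool) :
      SemiDec fun x : α × GroupWord => encode b ∈ (m x.1).eval (encode (subst (hs x.1) (f x))) :=
    .mem_eval (hm.comp .fst) (.comp .encode (primrec_subst.comp (hhs.comp .fst) hf)) (.const _)
  have h₁ : SemiDec fun x : α × GroupWord => x.2.IsOn (hs x.1).length :=
    (primrecRel_isOn.comp (.comp .list_length (hhs.comp .fst)) .snd).semiDec
  have h₂ : SemiDec fun x : α × GroupWord => x.2 ∈ ks x.1 :=
    (PrimrecRel.mem_list.comp .snd (hks.comp .fst)).semiDec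
  have h₃ : SemiDec fun x : (((α × GroupWord) × ℕ) × Bool) × GroupWord =>
      x.1.1.1.2 ++ [(x.1.1.2, x.1.2)] ++ FreeGroup.invRev x.2 ∈ ks x.1.1.1.1 := by
    have ha : Primrec fun x : (((α × GroupWord) × ℕ) × Bool) × GroupWord => x.1.1.1 :=
      .comp .fst (.comp .fst .fst)
    have hp : Primrec fun x : (((α × GroupWord) × ℕ) × Bool) × GroupWord => (x.1.1.2, x.1.2) :=
      .pair (.comp .snd (.comp .fst .fst)) (.comp .snd .fst)
    exact (PrimrecRel.mem_list.comp (Primrec.list_append.comp (Primrec.list_append.comp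
      (.comp .snd ha) (Primrec.list_cons.comp hp (.const [])))
      (FreeGroup.primrec_invRev.comp .snd)) (hks.comp (.comp .fst ha))).semiDec
  exact (PrimrecRel.mem_list.comp (.const []) hT).semiDec.and <|
    .and (.all_mem hks (.and h₁ (mem .snd true))) <|
    .and (.all_mem hT (.all_mem (.comp .list_range (.comp .list_length (hhs.comp .fst)))
      (.all_mem (.const _) (.ex_mem (hT.comp (.comp .fst (.comp .fst .fst))) h₃)))) <|
    .all_mem hT (.or h₂ (mem .snd false))

end SemiDec

/-! ### The uniform algorithms -/

/-- Generators of a subgroup of finite index are computable from a membership algorithm. -/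
theorem exists_generators_partrec :
    ∃ gens : ℕ × List GroupWord × Nat.Partrec.Code →. List GroupWord,
      Partrec gens ∧
      ∀ (G : Type u) [Group G] (F : Subgroup G) [F.FiniteIndex]
        (n : ℕ) (a : Fin n → G) (R : List GroupWord), Presents a R →
        ∀ m : Nat.Partrec.Code, DecidesMembership m a F →
          ∃ fs ∈ gens (n, R, m), ∃ f : Fin fs.length → F, GeneratesVia a F fs f := by
  let P := ℕ × List GroupWord × Nat.Partrec.Code
  have h : SemiDec fun x : P × List GroupWord => ∃ y : List GroupWord × List GroupWord,
      FindsPreimage x.1.2.2 (letters x.1.1) y.1 y.2 ∧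
      x.2 = y.1.map (subst (letters x.1.1)) := by
    have hl : Primrec fun x : (P × List GroupWord) × List GroupWord × List GroupWord =>
        letters x.1.1.1 := .comp primrec_letters (.comp .fst (.comp .fst .fst))
    have hm : Primrec fun x : (P × List GroupWord) × List GroupWord × List GroupWord =>
        x.1.1.2.2 := .comp .snd (.comp .snd (.comp .fst .fst))
    refine .ex (.and (.findsPreimage hm hl (.comp .fst .snd) (.comp .snd .snd))
      (PrimrecPred.semiDec ?_))
    exact Primrec.eq.comp (.comp .snd .fst) (Primrec.list_map (.comp .fst .snd)
      (primrec_subst.comp (hl.comp .fst) .snd))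
  obtain ⟨gens, hgens, H, hdom⟩ := h.exists_partrec
  refine ⟨gens, hgens, fun G _ F _ n a R hR m hm => ?_⟩
  obtain ⟨ks, T, hks⟩ := exists_findsPreimage hm (hs := letters n) fun h => isOn_of_mem_letters
  obtain ⟨fs, hfs⟩ := Part.dom_iff_mem.1
    (hdom (n, R, m) ⟨ks.map (subst (letters n)), (ks, T), hks, rfl⟩)
  obtain ⟨y, hy, hfs'⟩ := H _ _ hfs
  refine ⟨fs, hfs, ?_⟩
  obtain rfl : fs = y.1.map (subst (letters n)) := hfs'
  exact hy.exists_generatesVia hm hR.1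

/-- A coherence algorithm for a group is computable from a membership algorithm and a coherence
algorithm for a subgroup of finite index. -/
theorem exists_coherence_code_of_within :
    ∃ up : ℕ × List GroupWord × Nat.Partrec.Code × Nat.Partrec.Code → Nat.Partrec.Code,
      Computable up ∧
      ∀ (G : Type u) [Group G] (F : Subgroup G) [F.FiniteIndex]
        (n : ℕ) (a : Fin n → G) (R : List GroupWord), Presents a R →
        ∀ m : Nat.Partrec.Code, DecidesMembership m a F →
          ∀ c : Nat.Partrec.Code, IsCoherenceAlgorithmWithin c a F →
            IsCoherenceAlgorithm (up (n, R, m, c)) a := by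
  let P := ((ℕ × List GroupWord × Nat.Partrec.Code × Nat.Partrec.Code) × List GroupWord) ×
    List GroupWord
  have h : SemiDec fun x : P => ∃ y : List GroupWord × List GroupWord × List GroupWord,
      FindsPreimage x.1.1.2.2.1 x.1.2 y.1 y.2.1 ∧
      encode y.2.2 ∈ x.1.1.2.2.2.eval (encode (y.1.map (subst x.1.2))) ∧
      x.2 = y.2.2.map (subst y.1) := by
    let Q := P × List GroupWord × List GroupWord × List GroupWord
    have hmc : Primrec fun x : Q => x.1.1.1.2.2 :=
      .comp .snd (.comp .snd (.comp .fst (.comp .fst .fst)))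
    have hhs : Primrec fun x : Q => x.1.1.2 := .comp .snd (.comp .fst .fst)
    have hks : Primrec fun x : Q => x.2.1 := .comp .fst .snd
    have hT : Primrec fun x : Q => x.2.2.1 := .comp .fst (.comp .snd .snd)
    have hS : Primrec fun x : Q => x.2.2.2 := .comp .snd (.comp .snd .snd)
    refine .ex (.and (.findsPreimage (.comp .fst hmc) hhs hks hT)
      (.and (.mem_eval (.comp .snd hmc) (.comp .encode ?_) (.comp .encode hS))
        (PrimrecPred.semiDec ?_)))
    · exact Primrec.list_map hks (primrec_subst.comp (hhs.comp .fst) .snd)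
    · exact Primrec.eq.comp (.comp .snd .fst)
        (Primrec.list_map hS (primrec_subst.comp (hks.comp .fst) .snd))
  obtain ⟨up, hup, H⟩ := h.exists_code
  refine ⟨up, hup, fun G _ F _ n a R hR m hm c hc hs hhs => ?_⟩
  have hc' {ks T : List GroupWord} (h : FindsPreimage m hs ks T) := hc (ks.map (subst hs)) <| by
    intro w hw
    obtain ⟨k, hk, rfl⟩ := List.mem_map.1 hw
    exact ⟨isOn_subst hhs k,
      (hm.true_mem_eval_iff (isOn_subst hhs k)).1 (h.2.1 k hk).2⟩
  obtain ⟨out, hout, y, hy, hyS, rfl⟩ := H (n, R, m, c) hs <| by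
    obtain ⟨ks, T, hks⟩ := exists_findsPreimage hm hhs
    obtain ⟨S, hS, -⟩ := hc' hks
    exact ⟨_, (ks, T, S), hks, hS, rfl⟩
  refine ⟨_, hout, hy.isPresentationOn hm hhs ?_⟩
  -- Programs are single-valued, so the relators found by the search are those that `c` guarantees.
  obtain ⟨S, hS, hS'⟩ := hc' hy
  rwa [encode_injective (Part.mem_unique hyS hS)]

/-- A coherence algorithm for a subgroup that takes words on its own generators yields one that
takes words on the generators of the group. -/
theorem exists_within_code :
    ∃ wi : ℕ × List GroupWord × List GroupWord × Nat.Partrec.Code → Nat.Partrec.Code,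
      Computable wi ∧
      ∀ (G : Type u) [Group G] (F : Subgroup G)
        (n : ℕ) (a : Fin n → G) (R : List GroupWord), Presents a R →
        ∀ (fs : List GroupWord) (f : Fin fs.length → F), GeneratesVia a F fs f →
          ∀ c : Nat.Partrec.Code, IsCoherenceAlgorithm c f →
            IsCoherenceAlgorithmWithin (wi (n, R, fs, c)) a F := by
  let P := ((ℕ × List GroupWord × List GroupWord × Nat.Partrec.Code) × List GroupWord) ×
    List GroupWord
  -- `L` pairs each input word with a word on the generators of `F` spelling the same element,
  -- certified by the relators of `G`.
  have h : SemiDec fun x : P => ∃ L : List (GroupWord × GroupWord),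
      x.1.2 = L.map Prod.fst ∧
      (∀ y ∈ L, y.2.IsOn x.1.1.2.2.1.length ∧
        IsConsequence x.1.1.2.1 (y.1 ++ FreeGroup.invRev (subst x.1.1.2.2.1 y.2))) ∧
      encode x.2 ∈ x.1.1.2.2.2.eval (encode (L.map Prod.snd)) := by
    let Q := P × List (GroupWord × GroupWord)
    have hd : Primrec fun x : Q => x.1.1.1.2 := .comp .snd (.comp .fst (.comp .fst .fst))
    have hR : Primrec fun x : Q => x.1.1.1.2.1 := .comp .fst hd
    have hfs : Primrec fun x : Q => x.1.1.1.2.2.1 := .comp .fst (.comp .snd hd)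
    have hc : Primrec fun x : Q => x.1.1.1.2.2.2 := .comp .snd (.comp .snd hd)
    refine .ex (.and (PrimrecPred.semiDec ?_) (.and (.all_mem .snd (.and (PrimrecPred.semiDec ?_)
      (.isConsequence (hR.comp .fst) ?_))) (.mem_eval hc ?_ (.comp .encode (.comp .snd .fst)))))
    · exact Primrec.eq.comp (.comp .snd (.comp .fst .fst))
        (Primrec.list_map .snd (Primrec.fst.comp .snd))
    · exact primrecRel_isOn.comp (.comp .list_length (hfs.comp .fst)) (.comp .snd .snd)
    · exact Primrec.list_append.comp (.comp .fst .snd) (.comp FreeGroup.primrec_invRev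
        (primrec_subst.comp (hfs.comp .fst) (.comp .snd .snd)))
    · exact .comp .encode (Primrec.list_map .snd (Primrec.snd.comp .snd))
  obtain ⟨wi, hwi, H⟩ := h.exists_code
  refine ⟨wi, hwi, fun G _ F n a R hR fs f hf c hc hs hhs => ?_⟩
  obtain ⟨out, hout, L, rfl, hL, hLout⟩ := H (n, R, fs, c) hs <| by
    choose! g hg using fun h hh => (hf.eval_mem_iff h).1 (hhs h hh).2
    obtain ⟨out, hout, -⟩ := hc (hs.map g) <| by
      intro w hw
      obtain ⟨h, hh, rfl⟩ := List.mem_map.1 hw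
      exact (hg h hh).1
    refine ⟨out, hs.map fun h => (h, g h), by simp [Function.comp_def], ?_, by
      simpa [Function.comp_def] using hout⟩
    intro y hy
    obtain ⟨h, hh, rfl⟩ := List.mem_map.1 hy
    exact ⟨(hg h hh).1, (hR.isConsequence_append_invRev (hhs h hh).1 (isOn_subst hf.1 _)).2
      (hg h hh).2⟩
  refine ⟨out, hout, ?_⟩
  obtain ⟨out', hout', hpres⟩ := hc (L.map Prod.snd) <| by
    intro w hw
    obtain ⟨y, hy, rfl⟩ := List.mem_map.1 hw
    exact (hL y hy).1
  obtain rfl := encode_injective (Part.mem_unique hLout hout')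
  refine (IsPresentationOn.congr F.subtype F.subtype_injective (by simp) fun i => ?_).1 hpres
  have hi : i < L.length := by simpa using i.2
  have hy := List.getElem_mem hi
  simp only [List.get_eq_getElem, List.getElem_map, Fin.val_cast, F.coe_subtype, hf.coe_eval]
  exact ((hR.isConsequence_append_invRev (hhs _ (List.mem_map_of_mem hy)).1
    (isOn_subst hf.1 _)).1 (hL _ hy).2).symm

/-- A coherence algorithm for a group yields one for a subgroup. -/
theorem exists_coherence_code_subgroup :
    ∃ down : ℕ × List GroupWord × List GroupWord × Nat.Partrec.Code → Nat.Partrec.Code,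
      Computable down ∧
      ∀ (G : Type u) [Group G] (F : Subgroup G)
        (n : ℕ) (a : Fin n → G) (R : List GroupWord),
        ∀ (fs : List GroupWord) (f : Fin fs.length → F), GeneratesVia a F fs f →
          ∀ c : Nat.Partrec.Code, IsCoherenceAlgorithm c a →
            IsCoherenceAlgorithm (down (n, R, fs, c)) f := by
  let P := ((ℕ × List GroupWord × List GroupWord × Nat.Partrec.Code) × List GroupWord) ×
    List GroupWord
  have h : SemiDec fun x : P =>
      encode x.2 ∈ x.1.1.2.2.2.eval (encode (x.1.2.map (subst x.1.1.2.2.1))) := by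
    have hd : Primrec fun x : P => x.1.1.2.2 := .comp .snd (.comp .snd (.comp .fst .fst))
    refine .mem_eval (.comp .snd hd) (.comp .encode ?_) (.comp .encode .snd)
    exact Primrec.list_map (.comp .snd .fst)
      (primrec_subst.comp (.comp .fst (hd.comp .fst)) .snd)
  obtain ⟨down, hdown, H⟩ := h.exists_code
  refine ⟨down, hdown, fun G _ F n a R fs f hf c hc hs hhs => ?_⟩
  obtain ⟨out', hout', hpres⟩ := hc (hs.map (subst fs)) <| by
    intro w hw
    obtain ⟨k, -, rfl⟩ := List.mem_map.1 hw
    exact isOn_subst hf.1 k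
  obtain ⟨out, hout, h⟩ := H (n, R, fs, c) hs ⟨out', hout'⟩
  obtain rfl := encode_injective (Part.mem_unique h hout')
  refine ⟨out, hout, (IsPresentationOn.congr F.subtype F.subtype_injective (by simp)
    fun i => ?_).2 hpres⟩
  simp [hf.coe_eval]

/-- A coherence algorithm for a group is computable from generators and a coherence algorithm of a
subgroup of finite index. -/
theorem exists_coherence_code_of_subgroup :
    ∃ up : ℕ × List GroupWord × List GroupWord × Nat.Partrec.Code → Nat.Partrec.Code,
      Computable up ∧
      ∀ (G : Type u) [Group G] (F : Subgroup G) [F.FiniteIndex]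
        (n : ℕ) (a : Fin n → G) (R : List GroupWord), Presents a R →
        ∀ (fs : List GroupWord) (f : Fin fs.length → F), GeneratesVia a F fs f →
          ∀ c : Nat.Partrec.Code, IsCoherenceAlgorithm c f →
            IsCoherenceAlgorithm (up (n, R, fs, c)) a := by
  obtain ⟨memb, hmemb, Hmemb⟩ := exists_membership_code.{u}
  obtain ⟨wi, hwi, Hwi⟩ := exists_within_code.{u}
  obtain ⟨up, hup, Hup⟩ := exists_coherence_code_of_within.{u}
  refine ⟨fun x => up (x.1, x.2.1, memb (x.1, x.2.1, x.2.2.1), wi x), ?_,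
    fun G _ F _ n a R hR fs f hf c hc =>
      Hup G F n a R hR _ (Hmemb G F n a R hR fs f hf) _ (Hwi G F n a R hR fs f hf c hc)⟩
  have hR := Computable.fst.comp (Computable.snd (α := ℕ)
    (β := List GroupWord × List GroupWord × Nat.Partrec.Code))
  have hfs := Computable.fst.comp (Computable.snd.comp (Computable.snd (α := ℕ)
    (β := List GroupWord × List GroupWord × Nat.Partrec.Code)))
  exact hup.comp (Computable.fst.pair (hR.pair
    ((hmemb.comp (Computable.fst.pair (hR.pair hfs))).pair hwi)))

/-- Connects an arbitrary generating tuple of `F` with the uniform results, in which generators are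
given as words. -/
theorem exists_generatesVia_of_closure_eq_top {G : Type*} [Group G] {F : Subgroup G} {n : ℕ}
    {a : Fin n → G} (ha : Subgroup.closure (Set.range a) = ⊤) {r : ℕ} (f : Fin r → F)
    (hf : Subgroup.closure (Set.range f) = ⊤) :
    ∃ (fs : List GroupWord) (e : fs.length = r), GeneratesVia a F fs (f ∘ Fin.cast e) := by
  choose g hg hgf using fun i : Fin r => exists_eval_eq a (g := f i) (by rw [ha]; trivial)
  refine ⟨List.ofFn g, List.length_ofFn, ?_, fun i => ?_, ?_⟩
  · intro w hw
    obtain ⟨i, rfl⟩ := List.mem_ofFn.1 hw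
    exact hg i
  · simp [hgf]
    rfl
  · rw [← hf]
    congr 1
    exact (finCongr List.length_ofFn).surjective.range_comp f

theorem isEffectivelyCoherent_comp_cast {G : Type*} [Group G] {r s : ℕ} (f : Fin r → G)
    (e : s = r) : IsEffectivelyCoherent (f ∘ Fin.cast e) ↔ IsEffectivelyCoherent f := by
  subst e
  rfl

theorem mainTheorem1 :
    -- (i) coherence
    (∀ (G : Type u) [Group G] (F : Subgroup G) [F.FiniteIndex], IsCoherent F ↔ IsCoherent G) ∧
    -- (ii) effective coherence
    (∀ (G : Type u) [Group G] (F : Subgroup G) [F.FiniteIndex]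
      (n : ℕ) (a : Fin n → G) (R : List GroupWord), Presents a R →
      ∀ (r : ℕ) (f : Fin r → F), Subgroup.closure (Set.range f) = ⊤ →
        (IsEffectivelyCoherent f ↔ IsEffectivelyCoherent a)) ∧
    -- (ii), uniformly, for `F` given by generators: from an algorithm for `F` to one for `G`
    (∃ up : ℕ × List GroupWord × List GroupWord × Nat.Partrec.Code → Nat.Partrec.Code,
      Computable up ∧
      ∀ (G : Type u) [Group G] (F : Subgroup G) [F.FiniteIndex]
        (n : ℕ) (a : Fin n → G) (R : List GroupWord), Presents a R →
        ∀ (fs : List GroupWord) (f : Fin fs.length → F), GeneratesVia a F fs f →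
          ∀ c : Nat.Partrec.Code, IsCoherenceAlgorithm c f →
            IsCoherenceAlgorithm (up (n, R, fs, c)) a) ∧
    -- and from an algorithm for `G` to one for `F`
    (∃ down : ℕ × List GroupWord × List GroupWord × Nat.Partrec.Code → Nat.Partrec.Code,
      Computable down ∧
      ∀ (G : Type u) [Group G] (F : Subgroup G) [F.FiniteIndex]
        (n : ℕ) (a : Fin n → G) (R : List GroupWord), Presents a R →
        ∀ (fs : List GroupWord) (f : Fin fs.length → F), GeneratesVia a F fs f →
          ∀ c : Nat.Partrec.Code, IsCoherenceAlgorithm c a →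
            IsCoherenceAlgorithm (down (n, R, fs, c)) f) ∧
    -- (ii), uniformly, for `F` given by a membership algorithm `m`: the same two directions
    (∃ up : ℕ × List GroupWord × Nat.Partrec.Code × Nat.Partrec.Code → Nat.Partrec.Code,
      Computable up ∧
      ∀ (G : Type u) [Group G] (F : Subgroup G) [F.FiniteIndex]
        (n : ℕ) (a : Fin n → G) (R : List GroupWord), Presents a R →
        ∀ m : Nat.Partrec.Code, DecidesMembership m a F →
          ∀ c : Nat.Partrec.Code, IsCoherenceAlgorithmWithin c a F →
            IsCoherenceAlgorithm (up (n, R, m, c)) a) ∧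
    (∃ down : ℕ × List GroupWord × Nat.Partrec.Code × Nat.Partrec.Code → Nat.Partrec.Code,
      Computable down ∧
      ∀ (G : Type u) [Group G] (F : Subgroup G) [F.FiniteIndex]
        (n : ℕ) (a : Fin n → G) (R : List GroupWord), Presents a R →
        ∀ m : Nat.Partrec.Code, DecidesMembership m a F →
          ∀ c : Nat.Partrec.Code, IsCoherenceAlgorithm c a →
            IsCoherenceAlgorithmWithin (down (n, R, m, c)) a F) ∧
    -- the two ways of giving `F` are equivalent: from generators to a membership algorithm
    (∃ memb : ℕ × List GroupWord × List GroupWord → Nat.Partrec.Code,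
      Computable memb ∧
      ∀ (G : Type u) [Group G] (F : Subgroup G) [F.FiniteIndex]
        (n : ℕ) (a : Fin n → G) (R : List GroupWord), Presents a R →
        ∀ (fs : List GroupWord) (f : Fin fs.length → F), GeneratesVia a F fs f →
          DecidesMembership (memb (n, R, fs)) a F) ∧
    -- and from a membership algorithm to generators
    (∃ gens : ℕ × List GroupWord × Nat.Partrec.Code →. List GroupWord,
      Partrec gens ∧
      ∀ (G : Type u) [Group G] (F : Subgroup G) [F.FiniteIndex]
        (n : ℕ) (a : Fin n → G) (R : List GroupWord), Presents a R →
        ∀ m : Nat.Partrec.Code, DecidesMembership m a F →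
          ∃ fs ∈ gens (n, R, m), ∃ f : Fin fs.length → F, GeneratesVia a F fs f) := by
  refine ⟨fun G _ F _ => isCoherent_iff_of_finiteIndex F, ?_, exists_coherence_code_of_subgroup,
    ?_, exists_coherence_code_of_within, ?_, exists_membership_code, exists_generators_partrec⟩
  · intro G _ F _ n a R hR r f hf
    obtain ⟨fs, e, hfs⟩ := exists_generatesVia_of_closure_eq_top hR.1 f hf
    rw [← isEffectivelyCoherent_comp_cast f e]
    refine and_congr (isCoherent_iff_of_finiteIndex F) ⟨?_, ?_⟩
    · rintro ⟨c, hc⟩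
      obtain ⟨up, -, h⟩ := exists_coherence_code_of_subgroup.{u}
      exact ⟨_, h G F n a R hR fs _ hfs c hc⟩
    · rintro ⟨c, hc⟩
      obtain ⟨down, -, h⟩ := exists_coherence_code_subgroup.{u}
      exact ⟨_, h G F n a R fs _ hfs c hc⟩
  · obtain ⟨down, hdown, h⟩ := exists_coherence_code_subgroup.{u}
    exact ⟨down, hdown, fun G _ F _ n a R _ => h G F n a R⟩
  -- An algorithm for `G` already handles inputs lying in `F`, so it is returned unchanged.
  · exact ⟨fun x => x.2.2.2, Computable.snd.comp (Computable.snd.comp Computable.snd),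
      fun G _ F _ n a R _ m _ c hc hs hhs => hc hs fun h hh => (hhs h hh).1⟩
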